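/- Let $(A,\mathscr A,\mu)$ be a complete non-atomic measure space with $0<\mu(A)<\infty$, and let $(\Omega,\mathscr F,\mathbb P)$ be a separable, non-atomic probability space (non-atomic: every measurable set of positive measure has a measurable subset of strictly smaller positive measure; separable: there is a countable family of measurable sets that approximates every measurable set arbitrarily well in measure of the symmetric difference). A risk measure is a functional $\varrho:L^\infty(\mathbb P)\to\mathbb R$ that is monotone ($\mathcal X\ge\mathcal Y$ implies $\varrho(\mathcal X)\ge\varrho(\mathcal Y)$) and cash additive ($\varrho(\mathcal X+c)=\varrho(\mathcal X)+c$ for $c\in\mathbb R$); it is a convex risk measure if moreover $\varrho(\lambda\mathcal X+(1-\lambda)\mathcal Y)\le\lambda\varrho(\mathcal X)+(1-\lambda)\varrho(\mathcal Y)$ for $\lambda\in[0,1]$. A functional $\varrho:L^\infty(\mathbb P)\to\mathbb R$ has the Lebesgue property if $\varrho(\mathcal X^n)\to\varrho(\mathcal X)$ whenever $(\mathcal X^n)$ is an $L^\infty(\mathbb P)$-bounded sequence converging in probability to $\mathcal X\in L^\infty(\mathbb P)$. For a probability measure $\mathbb Q\ll\mathbb P$, $\varrho$ is $\mathbb Q$-consistent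 if $\varrho(\mathcal X)\le\varrho(\mathcal Y)$ whenever $\mathcal X,\mathcal Y\in L^\infty(\mathbb P)$ satisfy $\mathbb E^{\mathbb Q}(\varphi(\mathcal X))\le\mathbb E^{\mathbb Q}(\varphi(\mathcal Y))$ for all increasing (i.e. nondecreasing) convex $\varphi:\mathbb R\to\mathbb R$. An allocation $(X_a)_{a\in A}$ with $X_a\in L^\infty(\mathbb P)$ is $\mathscr A$-measurable if $a\mapsto\mathbb E^{\mathbb P}(X_a\mathcal Y)$ is $\mathscr A$-measurable for every $\mathcal Y\in L^1(\mathbb P)$. For $\mathcal X\in L^\infty(\mathbb P)$, let $\mathbb A(\mathcal X)$ be the set of $\mathscr A$-measurable allocations such that, for every $\mathcal Y\in L^1(\mathbb P)$, $a\mapsto\mathbb E^{\mathbb P}(X_a\mathcal Y)$ is $\mu$-integrable and $\int_A\mathbb E^{\mathbb P}(X_a\mathcal Y)\,\mu(da)=\mathbb E^{\mathbb P}(\mathcal X\mathcal Y)$ (that is, $\mathcal X$ is the Gelfand integral of $(X_a)_{a\in A}$). Let $(\varrho_a)_{a\in A}$ be a family of risk measures such that $a\mapsto\varrho_a(X_a)$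 is $\mathscr A$-measurable for every $\mathscr A$-measurable allocation $(X_a)_{a\in A}$. Define, for $\mathcal X\in L^\infty(\mathbb P)$, $$\Big(\mathop{\Box}_{a\in A}\varrho_a\,\mu(da)\Big)(\mathcal X)=\inf_{(X_a)_{a\in A}\in\mathbb A(\mathcal X)}\int_A\varrho_a(X_a)\,\mu(da)\in[-\infty,\infty],$$ where the integral is set to $+\infty$ whenever the positive part of its integrand has infinite integral. Theorem. Assume that: 1. there are a finite partition $\pi$ of $A$ into sets of $\mathscr A$ of positive $\mu$-measure and probability measures $\mathbb Q_B\sim\mathbb P$ ($B\in\pi$) such that $\varrho_a$ is $\mathbb Q_B$-consistent for each $B\in\pi$ and $a\in B$; 2. $\varrho_a$ has the Lebesgue property for each $a\in A$; 3. $\big(\mathop{\Box}_{a\in A}\varrho_a\,\mu(da)\big)(\mathcal X)\in\mathbb R$ for every $\mathcal X\in L^\infty(\mathbb P)$; 4. $a\mapsto\varrho_a(0)$ is $\mu$-integrable. Then $\mathop{\Box}_{a\in A}\varrho_a\,\mu(da)$ is a convex risk measure with the Lebesgue property. -/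

import Mathlib

open MeasureTheory Filter Topology Set
open scoped ENNReal

namespace RiskSharing

/-- A measure without atoms, in the measure-algebra sense: every measurable set of positive measure
splits off a measurable subset of strictly smaller positive measure. -/
def IsNonatomic {T : Type*} [MeasurableSpace T] (ν : Measure T) : Prop :=
  ∀ B : Set T, MeasurableSet B → 0 < ν B →
    ∃ C : Set T, MeasurableSet C ∧ C ⊆ B ∧ 0 < ν C ∧ ν C < ν B

section RiskMeasures

variable {Ω : Type*} [MeasurableSpace Ω]

/-- A risk measure is a real functional on `L^∞(P)` that is monotone and cash additive
(positive values represent losses). -/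
structure IsRiskMeasure (P : Measure Ω) [IsFiniteMeasure P] (r : Lp ℝ ∞ P → ℝ) : Prop where
  monotone : ∀ X Y : Lp ℝ ∞ P, Y ≤ X → r Y ≤ r X
  cash_additive : ∀ (X : Lp ℝ ∞ P) (c : ℝ), r (X + Lp.const ∞ P c) = r X + c

/-- A convex risk measure is a risk measure that is a convex functional on `L^∞(P)`. -/
structure IsConvexRiskMeasure (P : Measure Ω) [IsFiniteMeasure P] (r : Lp ℝ ∞ P → ℝ) : Prop
    extends IsRiskMeasure P r where
  convex : ∀ (X Y : Lp ℝ ∞ P) (l : ℝ), 0 ≤ l → l ≤ 1 →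
    r (l • X + (1 - l) • Y) ≤ l * r X + (1 - l) * r Y

/-- Lebesgue property: continuity along norm-bounded sequences that converge in probability. -/
def HasLebesgueProperty (P : Measure Ω) (r : Lp ℝ ∞ P → ℝ) : Prop :=
  ∀ (X : ℕ → Lp ℝ ∞ P) (Z : Lp ℝ ∞ P),
    (∃ C : ℝ, ∀ n, ‖X n‖ ≤ C) →
    TendstoInMeasure P (fun n => (X n : Ω → ℝ)) atTop (Z : Ω → ℝ) →
    Tendsto (fun n => r (X n)) atTop (𝓝 (r Z))

/-- `X` is second order stochastically dominated by `Y` under `Q` (used for `Q ≪ P`): expectations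
of all increasing convex test functions are ordered. -/
def SecondOrderDominated {P : Measure Ω} (Q : Measure Ω) (X Y : Lp ℝ ∞ P) : Prop :=
  ∀ φ : ℝ → ℝ, Monotone φ → ConvexOn ℝ Set.univ φ →
    ∫ ω, φ (X ω) ∂Q ≤ ∫ ω, φ (Y ω) ∂Q

/-- `Q`-consistency: preservation of second order stochastic dominance under `Q`. -/
def IsConsistent {P : Measure Ω} (Q : Measure Ω) (r : Lp ℝ ∞ P → ℝ) : Prop :=
  ∀ X Y : Lp ℝ ∞ P, SecondOrderDominated Q X Y → r X ≤ r Y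

end RiskMeasures

section Allocations

variable {A Ω : Type*} [MeasurableSpace A] [MeasurableSpace Ω]

/-- The duality pairing `E^P(X Y)` of `X ∈ L^∞(P)` and `Y ∈ L^1(P)`. -/
noncomputable def pairing {P : Measure Ω} (X : Lp ℝ ∞ P) (Y : Lp ℝ 1 P) : ℝ :=
  ∫ ω, X ω * Y ω ∂P

/-- An allocation is measurable if all its pairings with elements of `L^1(P)` are measurable. -/
def IsMeasurableAllocation {P : Measure Ω} (X : A → Lp ℝ ∞ P) : Prop :=
  ∀ Y : Lp ℝ 1 P, Measurable fun a => pairing (X a) Y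

/-- A measurable allocation is Gelfand integrable if all its pairings with elements of `L^1(P)` are
integrable. -/
def IsGelfandIntegrable (μ : Measure A) {P : Measure Ω} (X : A → Lp ℝ ∞ P) : Prop :=
  IsMeasurableAllocation X ∧ ∀ Y : Lp ℝ 1 P, Integrable (fun a => pairing (X a) Y) μ

/-- The set of `Z`-feasible allocations: Gelfand integrable, with Gelfand integral over the whole
agent space equal to `Z`. -/
def feasible (μ : Measure A) {P : Measure Ω} (Z : Lp ℝ ∞ P) : Set (A → Lp ℝ ∞ P) :=
  {X | IsGelfandIntegrable μ X ∧ ∀ Y : Lp ℝ 1 P, pairing Z Y = ∫ a, pairing (X a) Y ∂μ}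

/-- A family of functionals is measurable if it maps measurable allocations to measurable
real functions. -/
def IsMeasurableFamily {P : Measure Ω} (r : A → Lp ℝ ∞ P → ℝ) : Prop :=
  ∀ X : A → Lp ℝ ∞ P, IsMeasurableAllocation X → Measurable fun a => r a (X a)

open Classical in
/-- The extended-real integral of a measurable real function, with value `∞` as soon as the
integral of the positive part is infinite. -/
noncomputable def extIntegral (μ : Measure A) (f : A → ℝ) : EReal :=
  if ∫⁻ a, ENNReal.ofReal (f a) ∂μ = ∞ then ⊤
  else ((∫⁻ a, ENNReal.ofReal (f a) ∂μ : ℝ≥0∞) : EReal)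
    - ((∫⁻ a, ENNReal.ofReal (-f a) ∂μ : ℝ≥0∞) : EReal)

/-- The integral infimal convolution of the family `r`, with values in the extended reals. -/
noncomputable def integralInfConv (μ : Measure A) {P : Measure Ω} (r : A → Lp ℝ ∞ P → ℝ)
    (Z : Lp ℝ ∞ P) : EReal :=
  ⨅ X ∈ feasible μ Z, extIntegral μ fun a => r a (X a)

end Allocations

end RiskSharing

/-! Convexity comes from the absence of atoms in the agent space. Given near-optimal allocations X
and Y for two aggregate positions, a set D of agents that receive X, while the others receive Y,
should carry the fraction l of both the integral of X - Y and the integral of the risk difference;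
Lyapunov's theorem suggests that D exists. It cannot be applied directly, since X and Y are only
Gelfand integrable with values in an infinite-dimensional space.

The remedy is to replace X_a by its conditional expectation under Q_B (B the block of a) given a
finite σ-algebra. By Jensen and consistency this does not raise the risk, and being a finite-rank
operation it makes the allocation Bochner integrable, so that an approximate Lyapunov theorem
applies (`IsNonatomic.exists_norm_setIntegral_sub_lt`). By separability and martingale convergence,
the aggregate positions converge boundedly almost everywhere to the original ones
(`tendsto_integral_blockwise`). The remaining mismatch V_n is shared equally among all agents; the
Lebesgue property of each agent and dominated convergence make its cost vanish
(`tendsto_integral_excess`). Letting n tend to infinity gives `infConv_le_of_mem_feasible`.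

For the Lebesgue property, equal sharing of the perturbation gives the upper estimate
(`infConv_eventually_lt`). The lower one follows by convexity, because Z is the midpoint of X_n and
its reflection 2Z - X_n. -/

namespace RiskSharing

/-! ### Duality between L^∞ and L^1. -/

section Pairing

variable {Ω : Type*} [MeasurableSpace Ω] {P : Measure Ω}

theorem ae_abs_le_norm (X : Lp ℝ ∞ P) : ∀ᵐ ω ∂P, |X ω| ≤ ‖X‖ := by
  have h := ae_le_eLpNormEssSup (f := X) (μ := P)
  filter_upwards [h] with ω hω
  rw [Lp.norm_def, eLpNorm_exponent_top, ← Real.norm_eq_abs, ← toReal_enorm]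
  refine ENNReal.toReal_mono ?_ hω
  rw [← eLpNorm_exponent_top]
  exact (Lp.memLp X).eLpNorm_ne_top

theorem norm_le_of_ae_abs_le {X : Lp ℝ ∞ P} {C : ℝ} (hC : 0 ≤ C) (h : ∀ᵐ ω ∂P, |X ω| ≤ C) :
    ‖X‖ ≤ C := by
  rw [Lp.norm_def, eLpNorm_exponent_top]
  refine ENNReal.toReal_le_of_le_ofReal hC (eLpNormEssSup_le_of_ae_bound ?_)
  simpa using h

theorem integrable_pairing (X : Lp ℝ ∞ P) (Y : Lp ℝ 1 P) :
    Integrable (fun ω => X ω * Y ω) P :=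
  (L1.integrable_coeFn Y).bdd_mul (Lp.aestronglyMeasurable X) (c := ‖X‖)
    (by simpa using ae_abs_le_norm X)

theorem abs_pairing_le (X : Lp ℝ ∞ P) (Y : Lp ℝ 1 P) : |pairing X Y| ≤ ‖X‖ * ‖Y‖ := by
  rw [L1.norm_eq_integral_norm, ← integral_const_mul, ← Real.norm_eq_abs]
  refine (norm_integral_le_integral_norm _).trans
    (integral_mono_ae (integrable_pairing X Y).norm ((L1.integrable_coeFn Y).norm.const_mul _) ?_)
  filter_upwards [ae_abs_le_norm X] with ω hω
  simp only [norm_mul, Real.norm_eq_abs]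
  exact mul_le_mul_of_nonneg_right hω (abs_nonneg _)

theorem pairing_add_left (X X' : Lp ℝ ∞ P) (Y : Lp ℝ 1 P) :
    pairing (X + X') Y = pairing X Y + pairing X' Y := by
  rw [pairing, pairing, pairing, ← integral_add (integrable_pairing X Y) (integrable_pairing X' Y)]
  refine integral_congr_ae ?_
  filter_upwards [Lp.coeFn_add X X'] with ω hω
  rw [hω, Pi.add_apply, add_mul]

theorem pairing_smul_left (c : ℝ) (X : Lp ℝ ∞ P) (Y : Lp ℝ 1 P) :
    pairing (c • X) Y = c * pairing X Y := by
  rw [pairing, pairing, ← integral_const_mul]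
  refine integral_congr_ae ?_
  filter_upwards [Lp.coeFn_smul c X] with ω hω
  rw [hω, Pi.smul_apply, smul_eq_mul, mul_assoc]

theorem pairing_add_right (X : Lp ℝ ∞ P) (Y Y' : Lp ℝ 1 P) :
    pairing X (Y + Y') = pairing X Y + pairing X Y' := by
  rw [pairing, pairing, pairing, ← integral_add (integrable_pairing X Y) (integrable_pairing X Y')]
  refine integral_congr_ae ?_
  filter_upwards [Lp.coeFn_add Y Y'] with ω hω
  rw [hω, Pi.add_apply, mul_add]

theorem pairing_smul_right (c : ℝ) (X : Lp ℝ ∞ P) (Y : Lp ℝ 1 P) :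
    pairing X (c • Y) = c * pairing X Y := by
  rw [pairing, pairing, ← integral_const_mul]
  refine integral_congr_ae ?_
  filter_upwards [Lp.coeFn_smul c Y] with ω hω
  rw [hω, Pi.smul_apply, smul_eq_mul, mul_left_comm]

/-- The pairing with a fixed element of `L^1` as a continuous linear functional on `L^∞`. -/
noncomputable def pairingLeft (Y : Lp ℝ 1 P) : Lp ℝ ∞ P →L[ℝ] ℝ :=
  LinearMap.mkContinuous
    { toFun := fun X => pairing X Y
      map_add' := fun X X' => pairing_add_left X X' Y
      map_smul' := fun c X => pairing_smul_left c X Y } ‖Y‖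
    (fun X => (abs_pairing_le X Y).trans_eq (mul_comm _ _))

/-- The pairing with a fixed element of `L^∞` as a continuous linear functional on `L^1`. -/
noncomputable def pairingRight (X : Lp ℝ ∞ P) : Lp ℝ 1 P →L[ℝ] ℝ :=
  LinearMap.mkContinuous
    { toFun := fun Y => pairing X Y
      map_add' := fun Y Y' => pairing_add_right X Y Y'
      map_smul' := fun c Y => pairing_smul_right c X Y } ‖X‖
    (fun Y => abs_pairing_le X Y)

@[simp] theorem pairingLeft_apply (X : Lp ℝ ∞ P) (Y : Lp ℝ 1 P) :
    pairingLeft Y X = pairing X Y := rfl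

theorem pairing_indicatorConstLp [IsFiniteMeasure P] (X : Lp ℝ ∞ P) {s : Set Ω}
    (hs : MeasurableSet s) :
    pairing X (indicatorConstLp 1 hs (measure_ne_top P s) 1) = ∫ ω in s, X ω ∂P := by
  rw [pairing, ← integral_indicator hs]
  refine integral_congr_ae ?_
  filter_upwards [indicatorConstLp_coeFn (p := 1) (hs := hs) (hμs := measure_ne_top P s)
    (c := (1 : ℝ))] with ω hω
  rw [hω]
  by_cases h : ω ∈ s <;> simp [h]

theorem integrable_coeFn_top [IsFiniteMeasure P] (X : Lp ℝ ∞ P) : Integrable X P :=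
  (Lp.memLp X).integrable le_top

theorem eq_of_pairing_eq [IsFiniteMeasure P] {X X' : Lp ℝ ∞ P}
    (h : ∀ Y : Lp ℝ 1 P, pairing X Y = pairing X' Y) : X = X' := by
  refine Lp.ext ((integrable_coeFn_top X).ae_eq_of_forall_setIntegral_eq _ _
    (integrable_coeFn_top X') fun s hs _ => ?_)
  rw [← pairing_indicatorConstLp X hs, ← pairing_indicatorConstLp X' hs, h]

end Pairing

section Convergence

variable {Ω : Type*} [MeasurableSpace Ω] {P : Measure Ω}

theorem tendstoInMeasure_of_abs_sub_le {f f' : ℕ → Ω → ℝ} {g g' : Ω → ℝ} {K : ℝ} (hK : 0 < K)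
    (h : ∀ n, ∀ᵐ ω ∂P, |f' n ω - g' ω| ≤ K * |f n ω - g ω|)
    (hf : TendstoInMeasure P f atTop g) : TendstoInMeasure P f' atTop g' := by
  rw [tendstoInMeasure_iff_norm] at hf ⊢
  intro ε hε
  refine tendsto_of_tendsto_of_tendsto_of_le_of_le tendsto_const_nhds
    (hf (ε / K) (div_pos hε hK)) (fun n => zero_le) (fun n => measure_mono_ae ?_)
  filter_upwards [h n] with ω hω hmem
  change ε / K ≤ |f n ω - g ω|
  rw [div_le_iff₀ hK, mul_comm]
  exact le_trans hmem hω

end Convergence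

/-! ### Nonatomic measures: Sierpiński's theorem and approximate Lyapunov convexity. -/

section Nonatomic

variable {T : Type*} [MeasurableSpace T] {ν : Measure T} [IsFiniteMeasure ν]

theorem IsNonatomic.exists_subset_half (h : IsNonatomic ν) {S : Set T} (hS : MeasurableSet S)
    (hpos : 0 < ν.real S) :
    ∃ C, MeasurableSet C ∧ C ⊆ S ∧ 0 < ν.real C ∧ ν.real C ≤ ν.real S / 2 := by
  obtain ⟨C, hC, hCS, h0, hlt⟩ := h S hS (by
    rw [measureReal_def, ENNReal.toReal_pos_iff] at hpos; exact hpos.1)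
  have h0' : 0 < ν.real C := ENNReal.toReal_pos h0.ne' (measure_ne_top _ _)
  have hlt' : ν.real C < ν.real S :=
    (ENNReal.toReal_lt_toReal (measure_ne_top _ _) (measure_ne_top _ _)).2 hlt
  rcases le_total (ν.real C) (ν.real S / 2) with hc | hc
  · exact ⟨C, hC, hCS, h0', hc⟩
  -- Of the two pieces of S, the complement of C is then the smaller one.
  · have hd := measureReal_sdiff (μ := ν) hCS hC
    exact ⟨S \ C, hS.diff hC, sdiff_subset, by linarith, by linarith⟩

theorem IsNonatomic.exists_subset_lt (h : IsNonatomic ν) {S : Set T} (hS : MeasurableSet S)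
    (hpos : 0 < ν.real S) {ε : ℝ} (hε : 0 < ε) :
    ∃ C, MeasurableSet C ∧ C ⊆ S ∧ 0 < ν.real C ∧ ν.real C < ε := by
  have key : ∀ n : ℕ, ∃ C, MeasurableSet C ∧ C ⊆ S ∧ 0 < ν.real C ∧
      ν.real C ≤ ν.real S * (1 / 2) ^ n := by
    intro n
    induction n with
    | zero => exact ⟨S, hS, Subset.rfl, hpos, by simp⟩
    | succ n ih =>
      obtain ⟨C, hC, hCS, h0, hle⟩ := ih
      obtain ⟨C', hC', hCS', h0', hle'⟩ := h.exists_subset_half hC h0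
      exact ⟨C', hC', hCS'.trans hCS, h0', by rw [pow_succ]; linarith⟩
  have hlim : Tendsto (fun n : ℕ => ν.real S * (1 / 2 : ℝ) ^ n) atTop (𝓝 (ν.real S * 0)) :=
    (tendsto_pow_atTop_nhds_zero_of_lt_one (by norm_num) (by norm_num)).const_mul _
  rw [mul_zero] at hlim
  obtain ⟨n, hn⟩ := (hlim.eventually (gt_mem_nhds hε)).exists
  obtain ⟨C, hC, hCS, h0, hle⟩ := key n
  exact ⟨C, hC, hCS, h0, hle.trans_lt hn⟩

/-- Among the measurable sets with a property that is stable under increasing countable unions,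
there is one that is maximal with respect to the measure. -/
theorem exists_measure_maximal (p : Set T → Prop) (hp0 : p ∅)
    (hpU : ∀ D : ℕ → Set T, Monotone D → (∀ n, p (D n)) → p (⋃ n, D n)) :
    ∃ D, p D ∧ ∀ E, p E → D ⊆ E → ν.real E ≤ ν.real D := by
  -- Greedy exhaustion: each enlargement realizes at least half of the supremum of the possible
  -- gains.
  have step : ∀ D : {D // p D}, ∃ D' : {D // p D}, D.1 ⊆ D'.1 ∧
      ∀ E, p E → D.1 ⊆ E → ν.real E - ν.real D.1 ≤ 2 * (ν.real D'.1 - ν.real D.1) := by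
    intro D
    by_cases hD : ∃ E, p E ∧ D.1 ⊆ E ∧ ν.real D.1 < ν.real E
    · obtain ⟨E₀, hE₀, hDE₀, hlt⟩ := hD
      set K : Set ℝ := {x | ∃ E, p E ∧ D.1 ⊆ E ∧ ν.real E - ν.real D.1 = x}
      have hbdd : BddAbove K := by
        refine ⟨ν.real univ, ?_⟩
        rintro x ⟨E, -, -, rfl⟩
        have := measureReal_mono (μ := ν) (subset_univ E)
        have : 0 ≤ ν.real D.1 := measureReal_nonneg
        linarith
      have hpos : 0 < sSup K :=
        (sub_pos.2 hlt).trans_le (le_csSup hbdd ⟨E₀, hE₀, hDE₀, rfl⟩)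
      obtain ⟨x, ⟨E, hE, hDE, rfl⟩, hx⟩ := exists_lt_of_lt_csSup
        (⟨_, E₀, hE₀, hDE₀, rfl⟩ : K.Nonempty) (half_lt_self hpos)
      refine ⟨⟨E, hE⟩, hDE, fun F hF hDF => ?_⟩
      have := le_csSup hbdd (⟨F, hF, hDF, rfl⟩ : _ ∈ K)
      linarith
    · push Not at hD
      exact ⟨D, Subset.rfl, fun E hE hDE => by have := hD E hE hDE; linarith⟩
  choose g hg1 hg2 using step
  let D : ℕ → {D // p D} := fun n => g^[n] ⟨∅, hp0⟩
  have hsucc : ∀ n, D (n + 1) = g (D n) := fun n => Function.iterate_succ_apply' g n _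
  have hmono : Monotone fun n => (D n).1 :=
    monotone_nat_of_le_succ fun n => by rw [hsucc]; exact hg1 (D n)
  refine ⟨⋃ n, (D n).1, hpU _ hmono fun n => (D n).2, fun E hE hsub => ?_⟩
  have hlim : Tendsto (fun n => ν.real (D n).1) atTop (𝓝 (ν.real (⋃ n, (D n).1))) :=
    (ENNReal.tendsto_toReal (measure_ne_top _ _)).comp (tendsto_measure_iUnion_atTop hmono)
  have hlim' := hlim.comp (tendsto_add_atTop_nat 1)
  have h1 := (tendsto_const_nhds (x := ν.real E)).sub hlim
  have h2 := (hlim'.sub hlim).const_mul 2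
  rw [sub_self, mul_zero] at h2
  -- The gain still available to E is at most twice the n-th increment, and the increments of a
  -- convergent sequence tend to zero.
  have := le_of_tendsto_of_tendsto' h1 h2 fun n => by
    have := hg2 (D n) E hE ((subset_iUnion (fun n => (D n).1) n).trans hsub)
    simpa [hsucc] using this
  linarith

/-- Sierpiński's theorem: a nonatomic finite measure takes all intermediate values. -/
theorem IsNonatomic.exists_subset_measureReal_eq (h : IsNonatomic ν) {S : Set T}
    (hS : MeasurableSet S) {t : ℝ} (ht0 : 0 ≤ t) (ht : t ≤ ν.real S) :
    ∃ D, MeasurableSet D ∧ D ⊆ S ∧ ν.real D = t := by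
  obtain ⟨D, ⟨hDm, hDS, hDt⟩, hmax⟩ := exists_measure_maximal (ν := ν)
    (fun D => MeasurableSet D ∧ D ⊆ S ∧ ν.real D ≤ t) ⟨.empty, empty_subset _, by simpa⟩
    (fun D hmono hD =>
      ⟨.iUnion fun n => (hD n).1, iUnion_subset fun n => (hD n).2.1,
        le_of_tendsto' ((ENNReal.tendsto_toReal (measure_ne_top _ _)).comp
          (tendsto_measure_iUnion_atTop (μ := ν) hmono)) fun n => (hD n).2.2⟩)
  refine ⟨D, hDm, hDS, hDt.antisymm (not_lt.1 fun hlt => ?_)⟩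
  have hd := measureReal_sdiff (μ := ν) hDS hDm
  -- A piece of S \ D smaller than the deficit t - ν(D) could be added to D, against maximality.
  obtain ⟨C, hC, hCS, h0, hlt'⟩ := h.exists_subset_lt (hS.diff hDm) (by linarith)
    (sub_pos.2 hlt)
  have hu : ν.real (D ∪ C) = ν.real D + ν.real C :=
    measureReal_union (disjoint_sdiff_right.mono_right hCS) hC
  have := hmax (D ∪ C) ⟨hDm.union hC, union_subset hDS (hCS.trans sdiff_subset), by linarith⟩
    subset_union_left
  linarith

/-- Sierpiński's theorem takes the fraction l of each fiber of s; the union of these pieces works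
for all values of s at once. -/
theorem IsNonatomic.exists_setIntegral_simpleFunc_eq {E : Type*} [NormedAddCommGroup E]
    [NormedSpace ℝ E] [CompleteSpace E] (h : IsNonatomic ν) (s : SimpleFunc T E) {l : ℝ}
    (hl0 : 0 ≤ l) (hl1 : l ≤ 1) :
    ∃ D, MeasurableSet D ∧ ∫ a in D, s a ∂ν = l • ∫ a, s a ∂ν := by
  have key : ∀ x, ∃ D, MeasurableSet D ∧ D ⊆ s ⁻¹' {x} ∧
      ν.real D = l * ν.real (s ⁻¹' {x}) := fun x =>
    h.exists_subset_measureReal_eq (s.measurableSet_fiber x)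
      (mul_nonneg hl0 measureReal_nonneg) (mul_le_of_le_one_left measureReal_nonneg hl1)
  choose D hDm hDs hD using key
  refine ⟨⋃ x ∈ s.range, D x, Finset.measurableSet_biUnion _ fun x _ => hDm x, ?_⟩
  have hint : ∀ ν' : Measure T, IsFiniteMeasure ν' →
      ∫ a, s a ∂ν' = ∑ x ∈ s.range, ν'.real (s ⁻¹' {x}) • x := fun ν' _ =>
    SimpleFunc.integral_eq_sum s (SimpleFunc.integrable_of_isFiniteMeasure s)
  rw [hint _ inferInstance, hint _ inferInstance, Finset.smul_sum]
  refine Finset.sum_congr rfl fun x hx => ?_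
  rw [smul_smul, ← hD, measureReal_restrict_apply (s.measurableSet_fiber x)]
  congr 2
  ext a
  simp only [mem_inter_iff, mem_iUnion]
  constructor
  · rintro ⟨ha, y, hy, hay⟩
    have h1 : s a = x := ha
    have h2 : s a = y := hDs y hay
    rwa [← h1, h2]
  · exact fun ha => ⟨hDs x ha, x, hx, ha⟩

/-- Approximate Lyapunov convexity theorem for Bochner integrable densities. -/
theorem IsNonatomic.exists_norm_setIntegral_sub_lt {E : Type*} [NormedAddCommGroup E]
    [NormedSpace ℝ E] [CompleteSpace E] (h : IsNonatomic ν) {f : T → E} (hf : Integrable f ν) {l : ℝ}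
    (hl0 : 0 ≤ l) (hl1 : l ≤ 1) {ε : ℝ} (hε : 0 < ε) :
    ∃ D, MeasurableSet D ∧ ‖∫ a in D, f a ∂ν - l • ∫ a, f a ∂ν‖ < ε := by
  -- The L^1 error is paid twice, over D and over the whole space, hence ε / 2.
  obtain ⟨s, hs, hsm⟩ := (memLp_one_iff_integrable.2 hf).exists_simpleFunc_eLpNorm_sub_lt
    ENNReal.one_ne_top (ε := ENNReal.ofReal (ε / 2)) (by simpa using hε)
  have hsi : Integrable s ν := memLp_one_iff_integrable.1 hsm
  obtain ⟨D, hD, hDs⟩ := h.exists_setIntegral_simpleFunc_eq s hl0 hl1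
  refine ⟨D, hD, ?_⟩
  have hn : ∫ a, ‖f a - s a‖ ∂ν < ε / 2 := by
    rw [eLpNorm_one_eq_lintegral_enorm] at hs
    exact (integral_norm_eq_lintegral_enorm (hf.sub hsi).aestronglyMeasurable).trans_lt
      (ENNReal.toReal_lt_of_lt_ofReal hs)
  have e : ∫ a in D, f a ∂ν - l • ∫ a, f a ∂ν
      = ∫ a in D, (f a - s a) ∂ν - l • ∫ a, (f a - s a) ∂ν := by
    rw [integral_sub hf.integrableOn hsi.integrableOn, integral_sub hf hsi, smul_sub, hDs]
    abel
  rw [e]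
  have h1 : ‖∫ a in D, (f a - s a) ∂ν‖ ≤ ∫ a, ‖f a - s a‖ ∂ν :=
    (norm_integral_le_integral_norm _).trans
      (setIntegral_le_integral (hf.sub hsi).norm (.of_forall fun _ => norm_nonneg _))
  have h2 : ‖l • ∫ a, (f a - s a) ∂ν‖ ≤ ∫ a, ‖f a - s a‖ ∂ν := by
    rw [norm_smul, Real.norm_of_nonneg hl0]
    exact (mul_le_of_le_one_left (norm_nonneg _) hl1).trans (norm_integral_le_integral_norm _)
  linarith [norm_sub_le (∫ a in D, (f a - s a) ∂ν) (l • ∫ a, (f a - s a) ∂ν)]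

end Nonatomic

/-! ### Finite-rank conditional expectations on a separable probability space. -/

section ConditionalExpectation

variable {Ω : Type*} [mΩ : MeasurableSpace Ω] {P : Measure Ω}

/-- Sets of a σ-algebra generated by a measure-dense sequence agree almost everywhere with
arbitrary measurable sets. -/
theorem exists_generateFrom_ae_eq {t : ℕ → Set Ω}
    (ht : ∀ s, MeasurableSet s → ∀ ε : ℝ, 0 < ε → ∃ n, P (symmDiff s (t n)) < ENNReal.ofReal ε)
    {s : Set Ω} (hs : MeasurableSet s) :
    ∃ s', MeasurableSet[MeasurableSpace.generateFrom (range t)] s' ∧ s' =ᵐ[P] s := by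
  -- Summable errors, so that by Borel–Cantelli almost every point is eventually classified
  -- correctly.
  choose N hN using fun k : ℕ => ht s hs ((1 / 2) ^ k) (by positivity)
  refine ⟨limsup (fun k => t (N k)) atTop, ?_, ?_⟩
  · exact @MeasurableSet.measurableSet_limsup _ (_) _ fun k =>
      MeasurableSpace.measurableSet_generateFrom (mem_range_self _)
  · have hsum : ∑' k, P (symmDiff s (t (N k))) ≠ ∞ := by
      refine ne_top_of_le_ne_top ?_ (ENNReal.tsum_le_tsum fun k => (hN k).le)
      rw [← ENNReal.ofReal_tsum_of_nonneg (fun k => by positivity) summable_geometric_two]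
      exact ENNReal.ofReal_ne_top
    filter_upwards [ae_eventually_notMem hsum] with ω hω
    refine propext ?_
    change ω ∈ limsup (fun k => t (N k)) atTop ↔ ω ∈ s
    rw [mem_limsup_iff_frequently_mem]
    have h : ∀ᶠ k in atTop, (ω ∈ t (N k) ↔ ω ∈ s) := by
      filter_upwards [hω] with k hk
      rw [mem_symmDiff] at hk
      tauto
    rw [frequently_congr h, frequently_const]

theorem condExp_generateFrom_ae_eq {t : ℕ → Set Ω} (htm : ∀ n, MeasurableSet (t n))
    (ht : ∀ s, MeasurableSet s → ∀ ε : ℝ, 0 < ε → ∃ n, P (symmDiff s (t n)) < ENNReal.ofReal ε)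
    {Q : Measure Ω} [IsProbabilityMeasure Q] (hQP : Q ≪ P) {f : Ω → ℝ} (hf : Integrable f Q) :
    Q[f | MeasurableSpace.generateFrom (range t)] =ᵐ[Q] f := by
  have hle : MeasurableSpace.generateFrom (range t) ≤ mΩ :=
    MeasurableSpace.generateFrom_le (by rintro _ ⟨n, rfl⟩; exact htm n)
  refine integrable_condExp.ae_eq_of_forall_setIntegral_eq _ _ hf fun s hs _ => ?_
  obtain ⟨s', hs', hae⟩ := exists_generateFrom_ae_eq ht hs
  rw [← setIntegral_congr_set (hQP.ae_eq hae), ← setIntegral_congr_set (hQP.ae_eq hae),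
    setIntegral_condExp hle hf hs']

omit mΩ in
/-- A function that is measurable for the σ-algebra of a finite partition is constant on its
cells. -/
theorem eq_of_mem_memPartition {t : ℕ → Set Ω} {n : ℕ} {g : Ω → ℝ}
    (hg : Measurable[MeasurableSpace.generateFrom (memPartition t n)] g) {G : Set Ω}
    (hG : G ∈ memPartition t n) {ω ω' : Ω} (hω : ω ∈ G) (hω' : ω' ∈ G) : g ω' = g ω := by
  have hm := hg (measurableSet_singleton (g ω))
  obtain ⟨S, hS, hgS⟩ := (MeasurableSpace.measurableSet_generateFrom_memPartition_iff t n _).1 hm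
  have h1 : ω ∈ ⋃₀ (S : Set (Set Ω)) := by rw [← hgS]; rfl
  obtain ⟨G', hG', hωG'⟩ := h1
  have hGG : G = G' := by
    by_contra hne
    exact (disjoint_memPartition t n hG (hS hG') hne).le_bot ⟨hω, hωG'⟩
  have h2 : ω' ∈ ⋃₀ (S : Set (Set Ω)) := ⟨G', hG', hGG ▸ hω'⟩
  rw [← hgS] at h2
  exact h2


theorem integrable_comp_of_monotone {Q : Measure Ω} [IsProbabilityMeasure Q] (hQP : Q ≪ P)
    (X : Lp ℝ ∞ P) {φ : ℝ → ℝ} (hφ : Monotone φ) : Integrable (fun ω => φ (X ω)) Q := by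
  refine Integrable.of_mem_Icc (φ (-‖X‖)) (φ ‖X‖) ?_ ?_
  · exact hφ.measurable.comp_aemeasurable ((Lp.aestronglyMeasurable X).aemeasurable.mono_ac hQP)
  · filter_upwards [hQP.ae_le (ae_abs_le_norm X)] with ω hω
    exact ⟨hφ (abs_le.1 hω).1, hφ (abs_le.1 hω).2⟩

/-- Conditional Jensen inequality. This is the only way in which consistency is exploited: averaging
under Q cannot raise the risk. -/
theorem secondOrderDominated_of_ae_eq_condExp {Q : Measure Ω} [IsProbabilityMeasure Q]
    (hQP : Q ≪ P) (ℱ : Filtration ℕ mΩ) (n : ℕ) {X X' : Lp ℝ ∞ P}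
    (h : X' =ᵐ[P] Q[X | ℱ n]) : SecondOrderDominated Q X' X := by
  intro φ hmono hconv
  have hcont : Continuous φ := continuousOn_univ.1 (hconv.continuousOn isOpen_univ)
  have hX := integrable_comp_of_monotone hQP X hmono
  have hid := integrable_comp_of_monotone hQP X monotone_id
  have hj : φ ∘ Q[X | ℱ n] ≤ᵐ[Q] Q[φ ∘ X | ℱ n] :=
    hconv.map_condExp_le_univ (ℱ.le n) hcont.lowerSemicontinuous hid hX
  calc ∫ ω, φ (X' ω) ∂Q ≤ ∫ ω, (Q[φ ∘ X | ℱ n]) ω ∂Q := by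
        refine integral_mono_ae (integrable_comp_of_monotone hQP X' hmono) integrable_condExp ?_
        filter_upwards [hj, hQP.ae_le h] with ω h1 h2
        rw [h2]
        exact h1
    _ = ∫ ω, φ (X ω) ∂Q := integral_condExp (ℱ.le n)

/-- Operators on `L^∞` that are finite sums of rank-one operators with kernel in `L^1`. -/
def IsFiniteRank (T : Lp ℝ ∞ P → Lp ℝ ∞ P) : Prop :=
  ∃ (s : Finset (Set Ω)) (Y : Set Ω → Lp ℝ 1 P) (e : Set Ω → Lp ℝ ∞ P),
    ∀ X, T X = ∑ i ∈ s, pairing X (Y i) • e i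

variable [IsProbabilityMeasure P]

/-- The element of `L^1(P)` whose pairing with `X` is the average of `X` over `G` under `Q`. -/
noncomputable def averagingDensity (P Q : Measure Ω) [IsFiniteMeasure Q] (G : Set Ω) :
    Lp ℝ 1 P :=
  open Classical in
  if h : Integrable (fun ω => (Q.real G)⁻¹ * G.indicator (fun ω => (Q.rnDeriv P ω).toReal) ω) P
  then h.toL1 _ else 0

theorem pairing_averagingDensity {Q : Measure Ω} [IsProbabilityMeasure Q] (hQP : Q ≪ P)
    {G : Set Ω} (hG : MeasurableSet G) (X : Lp ℝ ∞ P) :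
    pairing X (averagingDensity P Q G) = (Q.real G)⁻¹ * ∫ ω in G, X ω ∂Q := by
  have h : Integrable
      (fun ω => (Q.real G)⁻¹ * G.indicator (fun ω => (Q.rnDeriv P ω).toReal) ω) P :=
    (Measure.integrable_toReal_rnDeriv.indicator hG).const_mul _
  rw [averagingDensity, dif_pos h, pairing, ← setIntegral_rnDeriv_smul hQP hG,
    ← integral_indicator hG, ← integral_const_mul]
  refine integral_congr_ae ?_
  filter_upwards [h.coeFn_toL1] with ω hω
  rw [hω]
  by_cases hmem : ω ∈ G
  · simp only [indicator_of_mem hmem, smul_eq_mul]; ring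
  · simp [indicator_of_notMem hmem]

/-- The conditional expectation of `X` under `Q` with respect to the finite σ-algebra generated by
the first `n` sets of the sequence `t`. -/
noncomputable def partitionExp (P : Measure Ω) [IsProbabilityMeasure P] (Q : Measure Ω)
    [IsFiniteMeasure Q] {t : ℕ → Set Ω} (htm : ∀ n, MeasurableSet (t n)) (n : ℕ)
    (X : Lp ℝ ∞ P) : Lp ℝ ∞ P :=
  ∑ G : memPartition t n, pairing X (averagingDensity P Q G) •
    indicatorConstLp ∞ (MeasurableSpace.measurableSet_memPartition htm n G.2) (measure_ne_top P _) (1 : ℝ)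

theorem isFiniteRank_partitionExp (Q : Measure Ω) [IsFiniteMeasure Q] {t : ℕ → Set Ω}
    (htm : ∀ n, MeasurableSet (t n)) (n : ℕ) : IsFiniteRank (partitionExp P Q htm n) := by
  classical
  refine ⟨(finite_memPartition t n).toFinset, averagingDensity P Q, fun G =>
    if h : G ∈ memPartition t n then
      indicatorConstLp ∞ (MeasurableSpace.measurableSet_memPartition htm n h) (measure_ne_top P _) (1 : ℝ) else 0,
    fun X => ?_⟩
  rw [partitionExp]
  refine Finset.sum_bij (fun G _ => G.1) (fun G _ => by simp) (fun G _ G' _ h => Subtype.ext h)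
    (fun G hG => ⟨⟨G, by simpa using hG⟩, Finset.mem_univ _, rfl⟩) (fun G _ => ?_)
  simp only [dif_pos G.2]

/-- The conditional expectation is constant on each cell, so on a cell of positive mass it equals
the average there. -/
theorem partitionExp_ae_eq {Q : Measure Ω} [IsProbabilityMeasure Q] (hQP : Q ≪ P) (hPQ : P ≪ Q)
    {t : ℕ → Set Ω} (htm : ∀ n, MeasurableSet (t n)) (n : ℕ) (X : Lp ℝ ∞ P)
    (hX : Integrable X Q) :
    partitionExp P Q htm n X =ᵐ[P] Q[X | MeasurableSpace.generateFrom (memPartition t n)] := by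
  have hle := MeasurableSpace.generateFrom_memPartition_le htm n
  have h1 : partitionExp P Q htm n X =ᵐ[P] fun ω => ∑ G : memPartition t n,
      pairing X (averagingDensity P Q G) * (G : Set Ω).indicator (fun _ => (1 : ℝ)) ω := by
    refine (Lp.coeFn_fun_finsetSum _ _).trans ?_
    have h : ∀ᵐ ω ∂P, ∀ G : memPartition t n, (pairing X (averagingDensity P Q G) •
        indicatorConstLp ∞ (MeasurableSpace.measurableSet_memPartition htm n G.2) (measure_ne_top P _) (1 : ℝ) :
          Lp ℝ ∞ P) ω = pairing X (averagingDensity P Q G) *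
            (G : Set Ω).indicator (fun _ => (1 : ℝ)) ω := by
      rw [ae_all_iff]
      intro G
      filter_upwards [Lp.coeFn_smul (pairing X (averagingDensity P Q G)) (indicatorConstLp ∞
        (MeasurableSpace.measurableSet_memPartition htm n G.2) (measure_ne_top P _) (1 : ℝ)),
        indicatorConstLp_coeFn (p := ∞) (hs := MeasurableSpace.measurableSet_memPartition htm n G.2)
          (hμs := measure_ne_top P _) (c := (1 : ℝ))] with ω h1 h2
      rw [h1, Pi.smul_apply, h2, smul_eq_mul]
    filter_upwards [h] with ω hω
    exact Finset.sum_congr rfl fun G _ => hω G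
  -- On a Q-null cell the inverse of the mass is the default value 0; such cells are also P-null,
  -- hence harmless.
  have hpos : ∀ᵐ ω ∂P, ∀ G : memPartition t n, ω ∈ (G : Set Ω) → Q.real G ≠ 0 := by
    rw [ae_all_iff]
    intro G
    by_cases h0 : Q.real G = 0
    · have : P G = 0 := hPQ ((measureReal_eq_zero_iff).1 h0)
      filter_upwards [measure_eq_zero_iff_ae_notMem.1 this] with ω hω hmem
      exact absurd hmem hω
    · exact .of_forall fun _ _ => h0
  filter_upwards [h1, hpos] with ω hω hωpos
  have hmem : ω ∈ ⋃₀ memPartition t n := by rw [sUnion_memPartition]; trivial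
  obtain ⟨G, hG, hωG⟩ := hmem
  have hGm : MeasurableSet[MeasurableSpace.generateFrom (memPartition t n)] G :=
    MeasurableSpace.measurableSet_generateFrom hG
  rw [hω, Finset.sum_eq_single (⟨G, hG⟩ : memPartition t n)]
  · rw [pairing_averagingDensity hQP (hle _ hGm), ← setIntegral_condExp hle hX hGm,
      indicator_of_mem hωG, mul_one]
    rw [setIntegral_congr_fun (g := fun _ =>
      (Q[X | MeasurableSpace.generateFrom (memPartition t n)]) ω) (hle _ hGm) fun ω' hω' =>
        eq_of_mem_memPartition stronglyMeasurable_condExp.measurable hG hωG hω']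
    rw [setIntegral_const, smul_eq_mul, inv_mul_cancel_left₀ (hωpos ⟨G, hG⟩ hωG)]
  · intro G' _ hne
    rw [indicator_of_notMem, mul_zero]
    intro hω'
    exact (disjoint_memPartition t n hG G'.2 (fun h => hne (Subtype.ext h.symm))).le_bot
      ⟨hωG, hω'⟩
  · simp

/-- Finite-rank conditional expectations under an equivalent measure that converge to the
identity. -/
theorem exists_finiteRank_approximation [IsSeparable P] :
    ∃ T : Measure Ω → ℕ → Lp ℝ ∞ P → Lp ℝ ∞ P, ∀ Q : Measure Ω, IsProbabilityMeasure Q →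
      Q ≪ P → P ≪ Q →
      (∀ n, IsFiniteRank (T Q n)) ∧
      (∀ n X, SecondOrderDominated Q (T Q n X) X) ∧
      (∀ n X, ‖T Q n X‖ ≤ ‖X‖) ∧
      ∀ X, ∀ᵐ ω ∂P, Tendsto (fun n => T Q n X ω) atTop (𝓝 (X ω)) := by
  classical
  obtain ⟨𝒜, hc, hd⟩ := exists_countable_measureDense P
  obtain ⟨t, rfl⟩ := hc.exists_eq_range hd.nonempty
  have htm : ∀ n, MeasurableSet (t n) := fun n => hd.measurable _ (mem_range_self n)
  have ht : ∀ s, MeasurableSet s → ∀ ε : ℝ, 0 < ε →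
      ∃ n, P (symmDiff s (t n)) < ENNReal.ofReal ε := fun s hs ε hε => by
    obtain ⟨_, ⟨n, rfl⟩, hn⟩ := hd.approx s hs (measure_ne_top _ _) ε hε
    exact ⟨n, hn⟩
  refine ⟨fun Q n X => if h : IsProbabilityMeasure Q then partitionExp P Q htm n X else X,
    fun Q hQ hQP hPQ => ?_⟩
  simp only [dif_pos hQ]
  have hint : ∀ X : Lp ℝ ∞ P, Integrable X Q := fun X =>
    integrable_comp_of_monotone hQP X monotone_id
  have hae := fun n X => partitionExp_ae_eq hQP hPQ htm n X (hint X)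
  refine ⟨isFiniteRank_partitionExp Q htm, fun n X => ?_, fun n X => ?_, fun X => ?_⟩
  · exact secondOrderDominated_of_ae_eq_condExp hQP
      (ProbabilityTheory.partitionFiltration htm) n (hae n X)
  · refine norm_le_of_ae_abs_le (norm_nonneg _) ?_
    have hb : ∀ᵐ ω ∂Q, |X ω| ≤ (‖X‖₊ : ℝ) := hQP.ae_le (ae_abs_le_norm X)
    filter_upwards [hae n X, hPQ.ae_le (ae_bdd_abs_condExp_of_ae_bdd_abs hb)] with ω h1 h2
    rw [h1]
    exact h2
  -- Lévy's upward theorem under Q; the limit σ-algebra is generated by a dense sequence, so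
  -- conditioning on it changes nothing.
  · have hF := tendsto_ae_condExp (μ := Q) (ℱ := ProbabilityTheory.partitionFiltration htm) X
    rw [ProbabilityTheory.iSup_partitionFiltration_eq_generateFrom_range] at hF
    filter_upwards [ae_all_iff.2 fun n => hae n X, hPQ.ae_le hF,
      hPQ.ae_le (condExp_generateFrom_ae_eq htm ht hQP (hint X))] with ω h1 h2 h3
    rw [← h3]
    exact h2.congr fun n => (h1 n).symm

end ConditionalExpectation

/-! ### The dual of L^1 is L^∞. -/

section Dual

variable {Ω : Type*} [MeasurableSpace Ω] {P : Measure Ω} [IsProbabilityMeasure P]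

/-- The inclusion of `L^2` into `L^1` over a probability space. -/
noncomputable def inclusionTwoOne (P : Measure Ω) [IsProbabilityMeasure P] :
    Lp ℝ 2 P →L[ℝ] Lp ℝ 1 P :=
  LinearMap.mkContinuous
    { toFun := fun f => ((Lp.memLp f).mono_exponent one_le_two).toLp f
      map_add' := fun f g => by
        rw [← MemLp.toLp_add]
        exact MemLp.toLp_congr _ _ (Lp.coeFn_add f g)
      map_smul' := fun c f => by
        rw [RingHom.id_apply, ← MemLp.toLp_const_smul]
        exact MemLp.toLp_congr _ _ (Lp.coeFn_smul c f) } 1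
    (fun f => by
      rw [one_mul, LinearMap.coe_mk, AddHom.coe_mk, Lp.norm_toLp, Lp.norm_def]
      exact ENNReal.toReal_mono (Lp.memLp f).eLpNorm_ne_top
        (eLpNorm_le_eLpNorm_of_exponent_le one_le_two (Lp.aestronglyMeasurable f)))

theorem inclusionTwoOne_indicatorConstLp {s : Set Ω} (hs : MeasurableSet s) (c : ℝ) :
    inclusionTwoOne P (indicatorConstLp 2 hs (measure_ne_top P s) c) =
      indicatorConstLp 1 hs (measure_ne_top P s) c :=
  MemLp.toLp_congr ((Lp.memLp _).mono_exponent one_le_two) _ indicatorConstLp_coeFn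

theorem pairing_indicatorConstLp_const (X : Lp ℝ ∞ P) {s : Set Ω} (hs : MeasurableSet s) (c : ℝ) :
    pairing X (indicatorConstLp 1 hs (measure_ne_top P s) c) = c * ∫ ω in s, X ω ∂P := by
  rw [← pairing_indicatorConstLp X hs, ← pairing_smul_right]
  congr 1
  refine Lp.ext ?_
  filter_upwards [Lp.coeFn_smul c (indicatorConstLp 1 hs (measure_ne_top P s) (1 : ℝ)),
    indicatorConstLp_coeFn (p := 1) (hs := hs) (hμs := measure_ne_top P s) (c := c),
    indicatorConstLp_coeFn (p := 1) (hs := hs) (hμs := measure_ne_top P s) (c := (1 : ℝ))]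
    with ω h1 h2 h3
  rw [h1, Pi.smul_apply, h2, h3]
  by_cases h : ω ∈ s <;> simp [h]

/-- Every continuous linear functional on `L^1` of a probability space is represented by an
element of `L^∞`. -/
theorem exists_pairing_eq (ℓ : Lp ℝ 1 P →L[ℝ] ℝ) : ∃ W : Lp ℝ ∞ P, ∀ Y, pairing W Y = ℓ Y := by
  -- Riesz representation in the Hilbert space L^2; the density found there is then shown to be
  -- bounded by the norm of ℓ.
  set w : Lp ℝ 2 P := (InnerProductSpace.toDual ℝ (Lp ℝ 2 P)).symm (ℓ.comp (inclusionTwoOne P))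
    with hw
  have hind : ∀ {s : Set Ω} (hs : MeasurableSet s) (c : ℝ),
      ℓ (indicatorConstLp 1 hs (measure_ne_top P s) c) = c * ∫ ω in s, w ω ∂P := by
    intro s hs c
    have h := InnerProductSpace.toDual_symm_apply (𝕜 := ℝ)
      (x := indicatorConstLp 2 hs (measure_ne_top P s) c) (y := ℓ.comp (inclusionTwoOne P))
    rw [← hw, real_inner_comm, L2.inner_indicatorConstLp_eq_inner_setIntegral,
      ContinuousLinearMap.comp_apply, inclusionTwoOne_indicatorConstLp] at h
    rw [← h]
    simp [mul_comm]
  have hwi : Integrable w P := (Lp.memLp w).integrable one_le_two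
  have hb : ∀ {s : Set Ω}, MeasurableSet s → |∫ ω in s, w ω ∂P| ≤ ∫ _ in s, ‖ℓ‖ ∂P := by
    intro s hs
    have h := ℓ.le_opNorm (indicatorConstLp 1 hs (measure_ne_top P s) (1 : ℝ))
    rw [hind hs, one_mul, norm_indicatorConstLp one_ne_zero ENNReal.one_ne_top] at h
    simpa [mul_comm] using h
  have hbound : ∀ᵐ ω ∂P, ‖w ω‖ ≤ ‖ℓ‖ := by
    have h1 : w ≤ᵐ[P] fun _ => ‖ℓ‖ := ae_le_of_forall_setIntegral_le hwi (integrable_const _)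
      fun s hs _ => (le_abs_self _).trans (hb hs)
    have h2 : (fun ω => -w ω) ≤ᵐ[P] fun _ => ‖ℓ‖ :=
      ae_le_of_forall_setIntegral_le hwi.neg (integrable_const _) fun s hs _ => by
        rw [integral_neg]
        exact (neg_le_abs _).trans (hb hs)
    filter_upwards [h1, h2] with ω h1 h2
    exact abs_le'.2 ⟨h1, h2⟩
  have hmem := memLp_top_of_bound (Lp.aestronglyMeasurable w) ‖ℓ‖ hbound
  refine ⟨hmem.toLp w, fun Y => ?_⟩
  induction Y using Lp.induction ENNReal.one_ne_top with
  | indicatorConst c hs hμs =>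
    rw [Lp.simpleFunc.coe_indicatorConst, pairing_indicatorConstLp_const _ hs, hind hs]
    congr 1
    exact integral_congr_ae (ae_restrict_of_ae hmem.coeFn_toLp)
  | add hf hg _ hfe hge => rw [pairing_add_right, hfe, hge, map_add]
  | isClosed => exact isClosed_eq (pairingRight (hmem.toLp w)).continuous ℓ.continuous

end Dual

/-! ### Existence of Gelfand integrals. -/

section Gelfand

variable {A Ω : Type*} [MeasurableSpace A] [MeasurableSpace Ω] {μ : Measure A} {P : Measure Ω}

theorem IsGelfandIntegrable.restrict {X : A → Lp ℝ ∞ P} (h : IsGelfandIntegrable μ X)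
    (B : Set A) : IsGelfandIntegrable (μ.restrict B) X :=
  ⟨h.1, fun Y => (h.2 Y).restrict⟩

/-- A Gelfand integrable family has a Gelfand integral. -/
theorem IsGelfandIntegrable.exists_integral [IsProbabilityMeasure P] {X : A → Lp ℝ ∞ P}
    (h : IsGelfandIntegrable μ X) :
    ∃ W : Lp ℝ ∞ P, ∀ Y, pairing W Y = ∫ a, pairing (X a) Y ∂μ := by
  let g : Lp ℝ 1 P →ₗ[ℝ] Lp ℝ 1 μ :=
    { toFun := fun Y => (h.2 Y).toL1 _
      map_add' := fun Y Y' => by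
        rw [← Integrable.toL1_add]
        exact (Integrable.toL1_eq_toL1_iff _ _ _ _).2
          (.of_forall fun a => pairing_add_right (X a) Y Y')
      map_smul' := fun c Y => by
        rw [RingHom.id_apply, ← Integrable.toL1_smul]
        exact (Integrable.toL1_eq_toL1_iff _ _ _ _).2
          (.of_forall fun a => pairing_smul_right c (X a) Y) }
  have hg : ∀ Y, g Y =ᵐ[μ] fun a => pairing (X a) Y := fun Y => (h.2 Y).coeFn_toL1
  -- Closed graph theorem: a subsequence of an L^1 convergent sequence converges almost everywhere,
  -- and there continuity of the pairing with X a identifies the limit.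
  have hcont : Continuous g := by
    refine g.continuous_of_seq_closed_graph fun u Y f hu hf => ?_
    obtain ⟨ns, hns, hae⟩ := (tendstoInMeasure_of_tendsto_Lp hf).exists_seq_tendsto_ae
    refine Lp.ext ?_
    filter_upwards [hae, hg Y, ae_all_iff.2 fun n => hg (u n)] with a h1 h2 h3
    rw [h2]
    refine tendsto_nhds_unique h1 ?_
    simp only [Function.comp_apply, h3]
    exact (((pairingRight (X a)).continuous.tendsto Y).comp hu).comp hns.tendsto_atTop
  obtain ⟨W, hW⟩ := exists_pairing_eq ((L1.integralCLM' ℝ).comp ⟨g, hcont⟩ : Lp ℝ 1 P →L[ℝ] ℝ)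
  refine ⟨W, fun Y => ?_⟩
  rw [hW, ← integral_congr_ae (hg Y)]
  exact ((L1.integral_eq_integral _).symm.trans (L1.integral_eq' ℝ _)).symm

end Gelfand

/-! ### The extended integral. -/

section ExtIntegral

variable {A : Type*} [MeasurableSpace A] {μ : Measure A}

theorem extIntegral_of_integrable {f : A → ℝ} (hf : Integrable f μ) :
    extIntegral μ f = ((∫ a, f a ∂μ : ℝ) : EReal) := by
  have hp : ∫⁻ a, ENNReal.ofReal (f a) ∂μ ≠ ∞ := hf.lintegral_lt_top.ne
  have hn : ∫⁻ a, ENNReal.ofReal (-f a) ∂μ ≠ ∞ := hf.neg.lintegral_lt_top.ne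
  rw [extIntegral, if_neg hp, integral_eq_lintegral_pos_part_sub_lintegral_neg_part hf,
    EReal.coe_sub, EReal.coe_ennreal_toReal hp, EReal.coe_ennreal_toReal hn]

theorem integrable_of_lintegral_ofReal_ne_top {f : A → ℝ} (hf : Measurable f)
    (hp : ∫⁻ a, ENNReal.ofReal (f a) ∂μ ≠ ∞) (hn : ∫⁻ a, ENNReal.ofReal (-f a) ∂μ ≠ ∞) :
    Integrable f μ := by
  refine ⟨hf.aestronglyMeasurable, ?_⟩
  have h : ∀ a, ‖f a‖ₑ = ENNReal.ofReal (f a) + ENNReal.ofReal (-f a) := fun a => by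
    rw [← ofReal_norm, Real.norm_eq_abs]
    rcases le_total 0 (f a) with h | h
    · rw [abs_of_nonneg h, ENNReal.ofReal_of_nonpos (neg_nonpos.2 h), add_zero]
    · rw [abs_of_nonpos h, ENNReal.ofReal_of_nonpos h, zero_add]
  rw [HasFiniteIntegral, lintegral_congr h, lintegral_add_left hf.ennreal_ofReal]
  exact ENNReal.add_lt_top.2 ⟨hp.lt_top, hn.lt_top⟩

theorem integrable_of_extIntegral_ne {f : A → ℝ} (hf : Measurable f)
    (hbot : extIntegral μ f ≠ ⊥) (htop : extIntegral μ f ≠ ⊤) : Integrable f μ := by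
  have hp : ∫⁻ a, ENNReal.ofReal (f a) ∂μ ≠ ∞ := fun h => htop (by rw [extIntegral, if_pos h])
  refine integrable_of_lintegral_ofReal_ne_top hf hp fun h => hbot ?_
  rw [extIntegral, if_neg hp, h, EReal.coe_ennreal_top, EReal.sub_top]

theorem extIntegral_le_of_le {f g : A → ℝ} (hf : Measurable f) (hg : Integrable g μ)
    (h : ∀ a, f a ≤ g a) : extIntegral μ f ≤ ((∫ a, g a ∂μ : ℝ) : EReal) := by
  have hp : ∫⁻ a, ENNReal.ofReal (f a) ∂μ ≠ ∞ := ne_top_of_le_ne_top hg.lintegral_lt_top.ne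
    (lintegral_mono fun a => ENNReal.ofReal_le_ofReal (h a))
  by_cases hn : ∫⁻ a, ENNReal.ofReal (-f a) ∂μ = ∞
  · rw [extIntegral, if_neg hp, hn, EReal.coe_ennreal_top, EReal.sub_top]
    exact bot_le
  · have hfi := integrable_of_lintegral_ofReal_ne_top hf hp hn
    rw [extIntegral_of_integrable hfi]
    exact EReal.coe_le_coe_iff.2 (integral_mono hfi hg h)

end ExtIntegral

/-! ### Risk measures are 1-Lipschitz in the sup norm. -/

section RiskMeasures

variable {Ω : Type*} [MeasurableSpace Ω] {P : Measure Ω} [IsProbabilityMeasure P]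

theorem le_add_const_norm (X Y : Lp ℝ ∞ P) : X ≤ Y + Lp.const ∞ P ‖X - Y‖ := by
  rw [← Lp.coeFn_le]
  filter_upwards [Lp.coeFn_add Y (Lp.const ∞ P ‖X - Y‖), Lp.coeFn_const (p := ∞) (μ := P) ‖X - Y‖,
    Lp.coeFn_sub X Y, ae_abs_le_norm (X - Y)] with ω h1 h2 h3 h4
  rw [h1, Pi.add_apply, h2, Function.const_apply]
  rw [h3, Pi.sub_apply] at h4
  linarith [(abs_le.1 h4).2]

theorem IsRiskMeasure.le_add_norm_sub {r : Lp ℝ ∞ P → ℝ} (hr : IsRiskMeasure P r)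
    (X Y : Lp ℝ ∞ P) : r X ≤ r Y + ‖X - Y‖ := by
  rw [← hr.cash_additive]
  exact hr.monotone _ _ (le_add_const_norm X Y)

theorem IsRiskMeasure.abs_sub_le_norm_sub {r : Lp ℝ ∞ P → ℝ} (hr : IsRiskMeasure P r)
    (X Y : Lp ℝ ∞ P) : |r X - r Y| ≤ ‖X - Y‖ := by
  have h1 := hr.le_add_norm_sub X Y
  have h2 := hr.le_add_norm_sub Y X
  rw [norm_sub_rev] at h2
  exact abs_le.2 ⟨by linarith, by linarith⟩

theorem HasLebesgueProperty.tendsto_of_ae {r : Lp ℝ ∞ P → ℝ} (hr : HasLebesgueProperty P r)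
    {X : ℕ → Lp ℝ ∞ P} {Z : Lp ℝ ∞ P} {C : ℝ} (hC : ∀ n, ‖X n‖ ≤ C)
    (h : ∀ᵐ ω ∂P, Tendsto (fun n => X n ω) atTop (𝓝 (Z ω))) :
    Tendsto (fun n => r (X n)) atTop (𝓝 (r Z)) :=
  hr X Z ⟨C, hC⟩ (tendstoInMeasure_of_tendsto_ae (fun n => Lp.aestronglyMeasurable (X n)) h)

end RiskMeasures

/-! ### Constructing feasible allocations. -/

section Feasible

variable {A Ω : Type*} [MeasurableSpace A] [MeasurableSpace Ω] {μ : Measure A}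
  {P : Measure Ω}

theorem isMeasurableAllocation_of_stronglyMeasurable {H : A → Lp ℝ ∞ P}
    (hH : StronglyMeasurable H) : IsMeasurableAllocation H := fun Y =>
  ((pairingLeft Y).continuous.comp_stronglyMeasurable hH).measurable

theorem mem_feasible_integral {H : A → Lp ℝ ∞ P} (hH : StronglyMeasurable H)
    (hi : Integrable H μ) : H ∈ feasible μ (∫ a, H a ∂μ) :=
  ⟨⟨isMeasurableAllocation_of_stronglyMeasurable hH, fun Y => (pairingLeft Y).integrable_comp hi⟩,
    fun Y => ((pairingLeft Y).integral_comp_comm hi).symm⟩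

theorem add_mem_feasible {X X' : A → Lp ℝ ∞ P} {Z Z' : Lp ℝ ∞ P} (hX : X ∈ feasible μ Z)
    (hX' : X' ∈ feasible μ Z') : (fun a => X a + X' a) ∈ feasible μ (Z + Z') := by
  refine ⟨⟨fun Y => ?_, fun Y => ?_⟩, fun Y => ?_⟩
  · simp only [pairing_add_left]
    exact (hX.1.1 Y).add (hX'.1.1 Y)
  · simp only [pairing_add_left]
    exact (hX.1.2 Y).add (hX'.1.2 Y)
  · simp only [pairing_add_left]
    rw [integral_add (hX.1.2 Y) (hX'.1.2 Y), hX.2, hX'.2]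

theorem const_mem_feasible [IsFiniteMeasure μ] (hμ : 0 < μ.real univ) (V : Lp ℝ ∞ P) :
    (fun _ => (μ.real univ)⁻¹ • V) ∈ feasible μ V := by
  have h := mem_feasible_integral (μ := μ) (stronglyMeasurable_const (b := (μ.real univ)⁻¹ • V))
    (integrable_const _)
  rwa [integral_const, smul_smul, mul_inv_cancel₀ hμ.ne', one_smul] at h

/-- Any discrepancy in the aggregate can be repaired by giving every agent the same share of it. -/
theorem shift_mem_feasible [IsFiniteMeasure μ] (hμ : 0 < μ.real univ) {X : A → Lp ℝ ∞ P}
    {Z : Lp ℝ ∞ P} (hX : X ∈ feasible μ Z) (Z' : Lp ℝ ∞ P) :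
    (fun a => X a + (μ.real univ)⁻¹ • (Z' - Z)) ∈ feasible μ Z' := by
  have h := add_mem_feasible hX (const_mem_feasible hμ (Z' - Z))
  rwa [add_sub_cancel] at h

end Feasible

/-! ### Monotonicity, cash additivity and Lebesgue property of the convolution. -/

section InfConvolution

variable {A Ω : Type*} [MeasurableSpace A] [MeasurableSpace Ω] {μ : Measure A}
  {P : Measure Ω} {r : A → Lp ℝ ∞ P → ℝ} {R : Lp ℝ ∞ P → ℝ}

theorem le_integral_of_mem_feasible (hr_meas : IsMeasurableFamily r)
    (hR : ∀ Z, integralInfConv μ r Z = (R Z : EReal)) {X : A → Lp ℝ ∞ P} {Z : Lp ℝ ∞ P}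
    (hX : X ∈ feasible μ Z) {g : A → ℝ} (hg : Integrable g μ) (h : ∀ a, r a (X a) ≤ g a) :
    R Z ≤ ∫ a, g a ∂μ := by
  rw [← EReal.coe_le_coe_iff, ← hR]
  exact (iInf₂_le X hX).trans (extIntegral_le_of_le (hr_meas X hX.1.1) hg h)

/-- Since the infimum is a real number, no feasible allocation has total risk -∞; a near-optimal one
thus has integrable risk. -/
theorem exists_mem_feasible_integral_lt (hr_meas : IsMeasurableFamily r)
    (hR : ∀ Z, integralInfConv μ r Z = (R Z : EReal)) (Z : Lp ℝ ∞ P) {ε : ℝ} (hε : 0 < ε) :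
    ∃ X ∈ feasible μ Z, Integrable (fun a => r a (X a)) μ ∧ ∫ a, r a (X a) ∂μ < R Z + ε := by
  have hlt : integralInfConv μ r Z < ((R Z + ε : ℝ) : EReal) := by
    rw [hR, EReal.coe_lt_coe_iff]
    linarith
  simp only [integralInfConv, iInf_lt_iff] at hlt
  obtain ⟨X, hX, hXlt⟩ := hlt
  have hle : (R Z : EReal) ≤ extIntegral μ fun a => r a (X a) := by
    rw [← hR]
    exact iInf₂_le X hX
  have hi : Integrable (fun a => r a (X a)) μ :=
    integrable_of_extIntegral_ne (hr_meas X hX.1.1)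
      ((EReal.bot_lt_coe _).trans_le hle).ne' (hXlt.trans (EReal.coe_lt_top _)).ne
  refine ⟨X, hX, hi, ?_⟩
  rwa [extIntegral_of_integrable hi, EReal.coe_lt_coe_iff] at hXlt

variable [IsFiniteMeasure μ] [IsProbabilityMeasure P]

theorem isRiskMeasure_infConv (hμ : 0 < μ.real univ) (hr_risk : ∀ a, IsRiskMeasure P (r a))
    (hr_meas : IsMeasurableFamily r) (hR : ∀ Z, integralInfConv μ r Z = (R Z : EReal)) :
    IsRiskMeasure P R where
  monotone X Y hYX := by
    refine le_of_forall_pos_lt_add fun ε hε => ?_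
    obtain ⟨U, hU, hi, hlt⟩ := exists_mem_feasible_integral_lt hr_meas hR X hε
    refine (le_integral_of_mem_feasible hr_meas hR (shift_mem_feasible hμ hU Y) hi
      fun a => (hr_risk a).monotone _ _ ?_).trans_lt hlt
    have h : (μ.real univ)⁻¹ • (Y - X) ≤ 0 := by
      rw [← Lp.coeFn_le] at hYX ⊢
      filter_upwards [hYX, Lp.coeFn_smul (μ.real univ)⁻¹ (Y - X), Lp.coeFn_sub Y X,
        Lp.coeFn_zero ℝ ∞ P] with ω h1 h2 h3 h4
      rw [h2, Pi.smul_apply, h3, h4]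
      exact mul_nonpos_of_nonneg_of_nonpos (inv_nonneg.2 hμ.le) (sub_nonpos.2 h1)
    exact add_le_of_nonpos_right h
  cash_additive := by
    have key : ∀ (X : Lp ℝ ∞ P) (c : ℝ), R (X + Lp.const ∞ P c) ≤ R X + c := by
      intro X c
      refine le_of_forall_pos_lt_add fun ε hε => ?_
      obtain ⟨U, hU, hi, hlt⟩ := exists_mem_feasible_integral_lt hr_meas hR X hε
      have h := le_integral_of_mem_feasible hr_meas hR
        (shift_mem_feasible hμ hU (X + Lp.const ∞ P c))
        (hi.add (integrable_const ((μ.real univ)⁻¹ * c))) fun a => ?_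
      · simp only [Pi.add_apply] at h
        rw [integral_add hi (integrable_const _), integral_const, smul_eq_mul,
          mul_inv_cancel_left₀ hμ.ne'] at h
        linarith
      · have hs : (μ.real univ)⁻¹ • (Lp.const ∞ P c : Lp ℝ ∞ P) =
            Lp.const ∞ P ((μ.real univ)⁻¹ * c) := by
          refine Lp.ext ?_
          filter_upwards [Lp.coeFn_smul (μ.real univ)⁻¹ (Lp.const ∞ P c : Lp ℝ ∞ P),
            Lp.coeFn_const (p := ∞) (μ := P) c,
            Lp.coeFn_const (p := ∞) (μ := P) ((μ.real univ)⁻¹ * c)] with ω h1 h2 h3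
          rw [h1, Pi.smul_apply, h2, h3]
          rfl
        rw [add_sub_cancel_left, hs, (hr_risk a).cash_additive]
        exact le_rfl
    intro X c
    refine (key X c).antisymm ?_
    -- The reverse inequality is the first one applied to the opposite shift.
    have h := key (X + Lp.const ∞ P c) (-c)
    rw [map_neg, add_neg_cancel_right] at h
    linarith

/-- A near-optimal allocation for Z, shifted by equal shares of X n - Z, is feasible for X n. The
Lipschitz bound provides the dominating function for the integrated risks. -/
theorem infConv_eventually_lt (hμ : 0 < μ.real univ) (hr_risk : ∀ a, IsRiskMeasure P (r a))
    (hr_meas : IsMeasurableFamily r) (hr_leb : ∀ a, HasLebesgueProperty P (r a))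
    (hR : ∀ Z, integralInfConv μ r Z = (R Z : EReal)) {X : ℕ → Lp ℝ ∞ P} {Z : Lp ℝ ∞ P}
    {C : ℝ} (hC : ∀ n, ‖X n‖ ≤ C)
    (h : TendstoInMeasure P (fun n => (X n : Ω → ℝ)) atTop (Z : Ω → ℝ)) {ε : ℝ} (hε : 0 < ε) :
    ∀ᶠ n in atTop, R (X n) < R Z + ε := by
  obtain ⟨U, hU, hi, hlt⟩ := exists_mem_feasible_integral_lt hr_meas hR Z hε
  set m := μ.real univ
  have hm : 0 ≤ m⁻¹ := inv_nonneg.2 hμ.le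
  have hV : ∀ n, ‖m⁻¹ • (X n - Z)‖ ≤ m⁻¹ * (C + ‖Z‖) := fun n => by
    rw [norm_smul, Real.norm_of_nonneg hm]
    exact mul_le_mul_of_nonneg_left ((norm_sub_le _ _).trans (by linarith [hC n])) hm
  have hfeas := fun n => shift_mem_feasible hμ hU (X n)
  have hmeas : ∀ n, Measurable fun a => r a (U a + m⁻¹ • (X n - Z)) := fun n =>
    hr_meas _ (hfeas n).1.1
  have hbound : ∀ n a, ‖r a (U a + m⁻¹ • (X n - Z))‖ ≤ ‖r a (U a)‖ + m⁻¹ * (C + ‖Z‖) := by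
    intro n a
    have h1 := (hr_risk a).abs_sub_le_norm_sub (U a + m⁻¹ • (X n - Z)) (U a)
    rw [add_sub_cancel_left] at h1
    have h2 := norm_le_norm_add_norm_sub' (r a (U a + m⁻¹ • (X n - Z))) (r a (U a))
    rw [Real.norm_eq_abs (_ - _)] at h2
    linarith [hV n]
  have hbi : Integrable (fun a => ‖r a (U a)‖ + m⁻¹ * (C + ‖Z‖)) μ :=
    hi.norm.add (integrable_const _)
  have hlim : Tendsto (fun n => ∫ a, r a (U a + m⁻¹ • (X n - Z)) ∂μ) atTop
      (𝓝 (∫ a, r a (U a) ∂μ)) := by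
    refine tendsto_integral_of_dominated_convergence _ (fun n => (hmeas n).aestronglyMeasurable)
      hbi (fun n => .of_forall (hbound n)) (.of_forall fun a => ?_)
    refine hr_leb a _ _ ⟨‖U a‖ + m⁻¹ * (C + ‖Z‖), fun n =>
      (norm_add_le _ _).trans (by linarith [hV n])⟩ ?_
    refine tendstoInMeasure_of_abs_sub_le (inv_pos.2 hμ) (fun n => ?_) h
    filter_upwards [Lp.coeFn_add (U a) (m⁻¹ • (X n - Z)), Lp.coeFn_smul m⁻¹ (X n - Z),
      Lp.coeFn_sub (X n) Z] with ω h1 h2 h3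
    rw [h1, Pi.add_apply, h2, Pi.smul_apply, h3, Pi.sub_apply, add_sub_cancel_left, smul_eq_mul,
      abs_mul, abs_of_nonneg hm]
  filter_upwards [hlim.eventually (gt_mem_nhds hlt)] with n hn
  exact (le_integral_of_mem_feasible hr_meas hR (hfeas n)
    (hbi.mono' (hmeas n).aestronglyMeasurable (.of_forall (hbound n))) fun _ => le_rfl).trans_lt hn

/-- A convex integral infimal convolution of functionals with the Lebesgue property inherits this
property. -/
theorem hasLebesgueProperty_infConv (hμ : 0 < μ.real univ)
    (hr_risk : ∀ a, IsRiskMeasure P (r a)) (hr_meas : IsMeasurableFamily r)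
    (hr_leb : ∀ a, HasLebesgueProperty P (r a))
    (hR : ∀ Z, integralInfConv μ r Z = (R Z : EReal))
    (hconv : ∀ (X Y : Lp ℝ ∞ P) (l : ℝ), 0 ≤ l → l ≤ 1 →
      R (l • X + (1 - l) • Y) ≤ l * R X + (1 - l) * R Y) :
    HasLebesgueProperty P R := by
  rintro X Z ⟨C, hC⟩ h
  have hrefl : TendstoInMeasure P (fun n => (Z + (Z - X n) : Lp ℝ ∞ P)) atTop (Z : Ω → ℝ) := by
    refine tendstoInMeasure_of_abs_sub_le one_pos (fun n => ?_) h
    filter_upwards [Lp.coeFn_add Z (Z - X n), Lp.coeFn_sub Z (X n)] with ω h1 h2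
    rw [h1, Pi.add_apply, h2, Pi.sub_apply, add_sub_cancel_left, one_mul, abs_sub_comm]
  have hCrefl : ∀ n, ‖Z + (Z - X n)‖ ≤ ‖Z‖ + (‖Z‖ + C) := fun n =>
    (norm_add_le _ _).trans (by linarith [norm_sub_le Z (X n), hC n])
  rw [Metric.tendsto_nhds]
  intro ε hε
  filter_upwards [infConv_eventually_lt hμ hr_risk hr_meas hr_leb hR hC h hε,
    infConv_eventually_lt hμ hr_risk hr_meas hr_leb hR hCrefl hrefl hε] with n h1 h2
  -- R (Z) ≤ (R (X n) + R (2Z - X n)) / 2 turns the upper estimate at the reflection into a lower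
  -- one at X n.
  have h3 := hconv (X n) (Z + (Z - X n)) (1 / 2) (by norm_num) (by norm_num)
  have e : (1 / 2 : ℝ) • X n + (1 - 1 / 2 : ℝ) • (Z + (Z - X n)) = Z := by module
  rw [e] at h3
  rw [Real.dist_eq, abs_lt]
  constructor <;> linarith

end InfConvolution

/-! ### Blockwise conditioning of allocations. -/

section Conditioning

variable {A Ω : Type*} [MeasurableSpace A] [MeasurableSpace Ω] {μ : Measure A}
  {P : Measure Ω}

/-- `b` sends each point to the block of the measurable finite partition `π` that contains it. -/
structure IsBlockMap (π : Finset (Set A)) (b : A → Set A) : Prop where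
  mem : ∀ a, b a ∈ π
  mem_block_iff : ∀ a, ∀ B ∈ π, a ∈ B ↔ b a = B
  measurableSet : ∀ B ∈ π, MeasurableSet B

theorem IsBlockMap.sum_indicator {E : Type*} [AddCommMonoid E] {π : Finset (Set A)}
    {b : A → Set A} (hb : IsBlockMap π b) (F : Set A → A → E) (a : A) :
    ∑ B ∈ π, B.indicator (F B) a = F (b a) a := by
  rw [Finset.sum_eq_single (b a)]
  · exact indicator_of_mem ((hb.mem_block_iff a _ (hb.mem a)).2 rfl) _
  · exact fun B hB hne =>
      indicator_of_notMem (fun ha => hne ((hb.mem_block_iff a B hB).1 ha).symm) _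
  · exact fun h => absurd (hb.mem a) h

theorem IsBlockMap.integral_eq_sum {E : Type*} [NormedAddCommGroup E] [NormedSpace ℝ E]
    {π : Finset (Set A)} {b : A → Set A} (hb : IsBlockMap π b) {F : Set A → A → E}
    (hF : ∀ B ∈ π, Integrable (F B) μ) :
    Integrable (fun a => F (b a) a) μ ∧
      ∫ a, F (b a) a ∂μ = ∑ B ∈ π, ∫ a in B, F B a ∂μ := by
  have hi : ∀ B ∈ π, Integrable (B.indicator (F B)) μ := fun B hB =>
    (hF B hB).indicator (hb.measurableSet B hB)
  simp only [← hb.sum_indicator F]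
  refine ⟨integrable_finsetSum _ hi, ?_⟩
  rw [integral_finsetSum _ hi]
  exact Finset.sum_congr rfl fun B hB => integral_indicator (hb.measurableSet B hB)

theorem IsFiniteRank.stronglyMeasurable_comp {T : Lp ℝ ∞ P → Lp ℝ ∞ P} (hT : IsFiniteRank T)
    {X : A → Lp ℝ ∞ P} (hX : IsMeasurableAllocation X) :
    StronglyMeasurable fun a => T (X a) := by
  obtain ⟨s, Y, e, h⟩ := hT
  simp only [h]
  exact Finset.stronglyMeasurable_fun_sum _ fun i _ =>
    (hX (Y i)).stronglyMeasurable.smul_const (e i)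

theorem IsFiniteRank.integrable_comp {T : Lp ℝ ∞ P → Lp ℝ ∞ P} (hT : IsFiniteRank T)
    {X : A → Lp ℝ ∞ P} (hX : IsGelfandIntegrable μ X) : Integrable (fun a => T (X a)) μ := by
  obtain ⟨s, Y, e, h⟩ := hT
  simp only [h]
  exact integrable_finsetSum _ fun i _ => (hX.2 (Y i)).smul_const (e i)

/-- A finite-rank operator sees the allocation only through finitely many pairings, so it commutes
with the Gelfand integral. -/
theorem IsFiniteRank.integral_comp {T : Lp ℝ ∞ P → Lp ℝ ∞ P} (hT : IsFiniteRank T)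
    {X : A → Lp ℝ ∞ P} (hX : IsGelfandIntegrable μ X) {W : Lp ℝ ∞ P}
    (hW : ∀ Y, pairing W Y = ∫ a, pairing (X a) Y ∂μ) : ∫ a, T (X a) ∂μ = T W := by
  obtain ⟨s, Y, e, h⟩ := hT
  simp only [h]
  rw [integral_finsetSum _ fun i _ => (hX.2 (Y i)).smul_const (e i)]
  exact Finset.sum_congr rfl fun i _ => by rw [integral_smul_const, hW]

variable [IsProbabilityMeasure P]

/-- Blockwise application of finite-rank approximations of the identity to a feasible allocation
gives Bochner integrable allocations whose integrals converge boundedly almost everywhere. -/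
theorem tendsto_integral_blockwise {π : Finset (Set A)} {b : A → Set A} (hb : IsBlockMap π b)
    {T : Set A → ℕ → Lp ℝ ∞ P → Lp ℝ ∞ P} (hfr : ∀ B ∈ π, ∀ n, IsFiniteRank (T B n))
    (hnorm : ∀ B ∈ π, ∀ n X, ‖T B n X‖ ≤ ‖X‖)
    (hlim : ∀ B ∈ π, ∀ X, ∀ᵐ ω ∂P, Tendsto (fun n => T B n X ω) atTop (𝓝 (X ω)))
    {X : A → Lp ℝ ∞ P} {Z : Lp ℝ ∞ P} (hX : X ∈ feasible μ Z) :
    (∀ n, StronglyMeasurable fun a => T (b a) n (X a)) ∧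
    (∀ n, Integrable (fun a => T (b a) n (X a)) μ) ∧
    (∃ K, ∀ n, ‖∫ a, T (b a) n (X a) ∂μ‖ ≤ K) ∧
    ∀ᵐ ω ∂P, Tendsto (fun n => (∫ a, T (b a) n (X a) ∂μ : Lp ℝ ∞ P) ω) atTop (𝓝 (Z ω)) := by
  -- W B is the aggregate of block B; the conditioned aggregate is the finite sum of the conditioned
  -- W B.
  choose W hW using fun B : Set A => (hX.1.restrict B).exists_integral
  have hint := fun n => hb.integral_eq_sum (F := fun B a => T B n (X a))
    fun B hB => (hfr B hB n).integrable_comp hX.1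
  have heq : ∀ n, ∫ a, T (b a) n (X a) ∂μ = ∑ B ∈ π, T B n (W B) := fun n =>
    (hint n).2.trans (Finset.sum_congr rfl fun B hB =>
      (hfr B hB n).integral_comp (hX.1.restrict B) (hW B))
  have hZ : ∑ B ∈ π, W B = Z := by
    refine eq_of_pairing_eq fun Y => ?_
    rw [← pairingLeft_apply, map_sum, hX.2,
      (hb.integral_eq_sum (F := fun _ a => pairing (X a) Y) fun _ _ => hX.1.2 Y).2]
    exact Finset.sum_congr rfl fun B _ => hW B Y
  refine ⟨fun n => ?_, fun n => (hint n).1, ⟨∑ B ∈ π, ‖W B‖, fun n => ?_⟩, ?_⟩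
  · simp only [← hb.sum_indicator fun B a => T B n (X a)]
    exact Finset.stronglyMeasurable_fun_sum _ fun B hB =>
      ((hfr B hB n).stronglyMeasurable_comp hX.1.1).indicator (hb.measurableSet B hB)
  · rw [heq]
    exact (norm_sum_le _ _).trans (Finset.sum_le_sum fun B hB => hnorm B hB n _)
  · simp only [heq]
    rw [← hZ]
    have h1 : ∀ᵐ ω ∂P, ∀ B ∈ π, Tendsto (fun n => T B n (W B) ω) atTop (𝓝 (W B ω)) :=
      (Filter.eventually_all_finset π).2 fun B hB => hlim B hB (W B)
    filter_upwards [h1, Lp.coeFn_fun_finsetSum π W,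
      ae_all_iff.2 fun n => Lp.coeFn_fun_finsetSum π fun B => T B n (W B)] with ω h1 h2 h3
    rw [h2]
    simp only [h3]
    exact tendsto_finsetSum _ h1

end Conditioning

/-! ### Convexity of the convolution. -/

section Convexity

variable {A Ω : Type*} [MeasurableSpace A] [MeasurableSpace Ω] {μ : Measure A}
  [IsFiniteMeasure μ] {P : Measure Ω} [IsProbabilityMeasure P] {r : A → Lp ℝ ∞ P → ℝ}

/-- The positive excess of the risk of a perturbed risk-reducing approximation over the risk of the
original allocation vanishes in the limit. -/
theorem tendsto_integral_excess (hr_risk : ∀ a, IsRiskMeasure P (r a))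
    (hr_meas : IsMeasurableFamily r) (hr_leb : ∀ a, HasLebesgueProperty P (r a))
    {X : A → Lp ℝ ∞ P} (hX : IsMeasurableAllocation X) {G : ℕ → A → Lp ℝ ∞ P}
    (hG : ∀ n, StronglyMeasurable (G n)) (hGr : ∀ n a, r a (G n a) ≤ r a (X a))
    (hGn : ∀ n a, ‖G n a‖ ≤ ‖X a‖)
    (hGlim : ∀ a, ∀ᵐ ω ∂P, Tendsto (fun n => G n a ω) atTop (𝓝 (X a ω)))
    {V : ℕ → Lp ℝ ∞ P} {C : ℝ} (hV : ∀ n, ‖V n‖ ≤ C)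
    (hVlim : ∀ᵐ ω ∂P, Tendsto (fun n => V n ω) atTop (𝓝 0)) :
    (∀ n, Integrable (fun a => max (r a (G n a + V n) - r a (X a)) 0) μ) ∧
    Tendsto (fun n => ∫ a, max (r a (G n a + V n) - r a (X a)) 0 ∂μ) atTop (𝓝 0) := by
  have hmeas : ∀ n, AEStronglyMeasurable (fun a => max (r a (G n a + V n) - r a (X a)) 0) μ :=
    fun n => ((((hr_meas _ (isMeasurableAllocation_of_stronglyMeasurable
      ((hG n).add stronglyMeasurable_const))).sub (hr_meas X hX)).max
        measurable_const)).aestronglyMeasurable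
  -- As G n is no riskier than X, the excess is at most the norm of V n: a constant dominates,
  -- although ‖X a‖ need not be integrable.
  have hbound : ∀ n a, ‖max (r a (G n a + V n) - r a (X a)) 0‖ ≤ C := by
    intro n a
    rw [Real.norm_of_nonneg (le_max_right _ _)]
    have h := (hr_risk a).le_add_norm_sub (G n a + V n) (G n a)
    rw [add_sub_cancel_left] at h
    exact max_le (by linarith [hGr n a, hV n]) ((norm_nonneg _).trans (hV n))
  refine ⟨fun n => (integrable_const C).mono' (hmeas n) (.of_forall (hbound n)), ?_⟩
  suffices hint : Tendsto (fun n => ∫ a, max (r a (G n a + V n) - r a (X a)) 0 ∂μ) atTop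
      (𝓝 (∫ _, (0 : ℝ) ∂μ)) by
    rwa [integral_zero] at hint
  refine tendsto_integral_of_dominated_convergence (fun _ => C) hmeas (integrable_const C)
    (fun n => .of_forall (hbound n)) (.of_forall fun a => ?_)
  have hlim : Tendsto (fun n => r a (G n a + V n)) atTop (𝓝 (r a (X a))) := by
    refine (hr_leb a).tendsto_of_ae (C := ‖X a‖ + C)
      (fun n => (norm_add_le _ _).trans (add_le_add (hGn n a) (hV n))) ?_
    filter_upwards [hGlim a, hVlim, ae_all_iff.2 fun n => Lp.coeFn_add (G n a) (V n)]
      with ω h1 h2 h3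
    simp only [h3, Pi.add_apply]
    simpa using h1.add h2
  simpa using (hlim.sub_const (r a (X a))).max (tendsto_const_nhds (x := (0 : ℝ)))

theorem infConv_le_of_mem_feasible (hμ : 0 < μ.real univ) (hμ_nonatomic : IsNonatomic μ)
    (hr_risk : ∀ a, IsRiskMeasure P (r a))
    (hr_meas : IsMeasurableFamily r) (hr_leb : ∀ a, HasLebesgueProperty P (r a))
    {R : Lp ℝ ∞ P → ℝ} (hR : ∀ Z, integralInfConv μ r Z = (R Z : EReal))
    {π : Finset (Set A)} {b : A → Set A} (hb : IsBlockMap π b)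
    {T : Set A → ℕ → Lp ℝ ∞ P → Lp ℝ ∞ P} (hfr : ∀ B ∈ π, ∀ n, IsFiniteRank (T B n))
    (hnorm : ∀ B ∈ π, ∀ n X, ‖T B n X‖ ≤ ‖X‖)
    (hlim : ∀ B ∈ π, ∀ X, ∀ᵐ ω ∂P, Tendsto (fun n => T B n X ω) atTop (𝓝 (X ω)))
    (hTr : ∀ a n X, r a (T (b a) n X) ≤ r a X)
    {X Y : A → Lp ℝ ∞ P} {ZX ZY : Lp ℝ ∞ P} (hX : X ∈ feasible μ ZX) (hY : Y ∈ feasible μ ZY)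
    (hXi : Integrable (fun a => r a (X a)) μ) (hYi : Integrable (fun a => r a (Y a)) μ)
    {l : ℝ} (hl0 : 0 ≤ l) (hl1 : l ≤ 1) :
    R (l • ZX + (1 - l) • ZY) ≤
      l * ∫ a, r a (X a) ∂μ + (1 - l) * ∫ a, r a (Y a) ∂μ := by
  obtain ⟨hXs, hXI, ⟨KX, hKX⟩, hXlim⟩ := tendsto_integral_blockwise hb hfr hnorm hlim hX
  obtain ⟨hYs, hYI, ⟨KY, hKY⟩, hYlim⟩ := tendsto_integral_blockwise hb hfr hnorm hlim hY
  set GX : ℕ → A → Lp ℝ ∞ P := fun n a => T (b a) n (X a)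
  set GY : ℕ → A → Lp ℝ ∞ P := fun n a => T (b a) n (Y a)
  set f : ℕ → A → Lp ℝ ∞ P := fun n a => GX n a - GY n a
  set ρ : A → ℝ := fun a => r a (X a) - r a (Y a)
  have hfi : ∀ n, Integrable (f n) μ := fun n => (hXI n).sub (hYI n)
  have hρi : Integrable ρ μ := hXi.sub hYi
  set δ : ℕ → ℝ := fun n => 1 / ((n : ℝ) + 1)
  have hδ : ∀ n, 0 < δ n := fun n => Nat.one_div_pos_of_nat
  have hδ1 : ∀ n, δ n ≤ 1 := fun n => by
    rw [div_le_one (by positivity)]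
    linarith [n.cast_nonneg (α := ℝ)]
  have hδlim : Tendsto δ atTop (𝓝 0) := tendsto_one_div_add_atTop_nhds_zero_nat
  -- Lyapunov for the pair (f n, ρ) in L^∞ × ℝ, so that one set D splits positions and risks
  -- simultaneously.
  have hLyap : ∀ n, ∃ D, MeasurableSet D ∧ ‖∫ a in D, f n a ∂μ - l • ∫ a, f n a ∂μ‖ ≤ δ n ∧
      |∫ a in D, ρ a ∂μ - l * ∫ a, ρ a ∂μ| ≤ δ n := by
    intro n
    obtain ⟨D, hD, h⟩ := hμ_nonatomic.exists_norm_setIntegral_sub_lt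
      ((hfi n).prodMk hρi) hl0 hl1 (hδ n)
    rw [integral_pair (hfi n) hρi, integral_pair (hfi n).integrableOn hρi.integrableOn] at h
    exact ⟨D, hD, (norm_fst_le _).trans h.le, (norm_snd_le _).trans h.le⟩
  choose D hD hDf hDρ using hLyap
  set Z := l • ZX + (1 - l) • ZY with hZ
  -- The allocation equal to GX n on D n and to GY n elsewhere.
  set H : ℕ → A → Lp ℝ ∞ P := fun n a => (D n).indicator (f n) a + GY n a with hH
  have hHs : ∀ n, StronglyMeasurable (H n) := fun n =>
    (((hXs n).sub (hYs n)).indicator (hD n)).add (hYs n)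
  have hHi : ∀ n, Integrable (H n) μ := fun n => ((hfi n).indicator (hD n)).add (hYI n)
  set E : ℕ → Lp ℝ ∞ P := fun n => ∫ a in D n, f n a ∂μ - l • ∫ a, f n a ∂μ with hE
  set IX : ℕ → Lp ℝ ∞ P := fun n => ∫ a, GX n a ∂μ
  set IY : ℕ → Lp ℝ ∞ P := fun n => ∫ a, GY n a ∂μ with hIY
  -- The mismatch splits into two conditioning errors, vanishing boundedly almost everywhere, and
  -- the Lyapunov error, vanishing in norm.
  have hres : ∀ n, Z - ∫ a, H n a ∂μ = l • (ZX - IX n) + (1 - l) • (ZY - IY n) - E n := by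
    intro n
    have h1 : ∫ a, H n a ∂μ = ∫ a in D n, f n a ∂μ + IY n := by
      rw [hIY, hH, integral_add ((hfi n).indicator (hD n)) (hYI n), integral_indicator (hD n)]
    have h2 : ∫ a, f n a ∂μ = IX n - IY n := integral_sub (hXI n) (hYI n)
    rw [hE, h1]
    simp only [h2, hZ]
    module
  set m := μ.real univ
  have hm : 0 ≤ m⁻¹ := inv_nonneg.2 hμ.le
  set V : ℕ → Lp ℝ ∞ P := fun n => m⁻¹ • (Z - ∫ a, H n a ∂μ) with hVdef
  have hV : ∀ n, ‖V n‖ ≤ m⁻¹ * ((‖ZX‖ + KX) + (‖ZY‖ + KY) + 1) := by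
    intro n
    rw [hVdef, norm_smul, Real.norm_of_nonneg hm, hres]
    refine mul_le_mul_of_nonneg_left ((norm_sub_le _ _).trans (add_le_add
      ((norm_add_le _ _).trans (add_le_add ?_ ?_)) ((hDf n).trans (hδ1 n)))) hm
    · rw [norm_smul, Real.norm_of_nonneg hl0]
      exact (mul_le_of_le_one_left (norm_nonneg _) hl1).trans
        ((norm_sub_le _ _).trans (add_le_add le_rfl (hKX n)))
    · rw [norm_smul, Real.norm_of_nonneg (sub_nonneg.2 hl1)]
      exact (mul_le_of_le_one_left (norm_nonneg _) (by linarith)).trans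
        ((norm_sub_le _ _).trans (add_le_add le_rfl (hKY n)))
  have hVlim : ∀ᵐ ω ∂P, Tendsto (fun n => V n ω) atTop (𝓝 0) := by
    have h1 : ∀ᵐ ω ∂P, ∀ n, V n ω =
        m⁻¹ * (l * (ZX ω - IX n ω) + (1 - l) * (ZY ω - IY n ω) - E n ω) := by
      rw [ae_all_iff]
      intro n
      rw [hVdef]
      simp only [hres]
      filter_upwards [Lp.coeFn_smul m⁻¹ (l • (ZX - IX n) + (1 - l) • (ZY - IY n) - E n),
        Lp.coeFn_sub (l • (ZX - IX n) + (1 - l) • (ZY - IY n)) (E n),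
        Lp.coeFn_add (l • (ZX - IX n)) ((1 - l) • (ZY - IY n)),
        Lp.coeFn_smul l (ZX - IX n), Lp.coeFn_smul (1 - l) (ZY - IY n),
        Lp.coeFn_sub ZX (IX n), Lp.coeFn_sub ZY (IY n)] with ω h1 h2 h3 h4 h5 h6 h7
      simp only [h1, h2, h3, h4, h5, h6, h7, Pi.smul_apply, Pi.add_apply, Pi.sub_apply,
        smul_eq_mul]
    filter_upwards [h1, hXlim, hYlim, ae_all_iff.2 fun n => ae_abs_le_norm (E n)]
      with ω h1 h2 h3 h4
    simp only [h1]
    have hE0 : Tendsto (fun n => E n ω) atTop (𝓝 0) :=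
      squeeze_zero_norm (fun n => (h4 n).trans (hDf n)) hδlim
    have hlim0 := ((((h2.const_sub (ZX ω)).const_mul l).add
      ((h3.const_sub (ZY ω)).const_mul (1 - l))).sub hE0).const_mul m⁻¹
    simpa using hlim0
  have hGlim : ∀ (U : A → Lp ℝ ∞ P) (a : A), ∀ᵐ ω ∂P,
      Tendsto (fun n => T (b a) n (U a) ω) atTop (𝓝 (U a ω)) := fun U a =>
    hlim _ (hb.mem a) (U a)
  obtain ⟨heXi, heX⟩ := tendsto_integral_excess (μ := μ) hr_risk hr_meas hr_leb hX.1.1 hXs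
    (fun n a => hTr a n (X a)) (fun n a => hnorm _ (hb.mem a) n _) (hGlim X) hV hVlim
  obtain ⟨heYi, heY⟩ := tendsto_integral_excess (μ := μ) hr_risk hr_meas hr_leb hY.1.1 hYs
    (fun n a => hTr a n (Y a)) (fun n a => hnorm _ (hb.mem a) n _) (hGlim Y) hV hVlim
  set eX : ℕ → A → ℝ := fun n a => max (r a (GX n a + V n) - r a (X a)) 0
  set eY : ℕ → A → ℝ := fun n a => max (r a (GY n a + V n) - r a (Y a)) 0
  -- The risk of H n + V n is at most that of X on D n and of Y elsewhere, up to the excesses;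
  -- integrating ρ over D n costs δ n.
  have hle : ∀ n, R Z ≤ (l * ∫ a, ρ a ∂μ + δ n) + ∫ a, r a (Y a) ∂μ + ∫ a, eX n a ∂μ
      + ∫ a, eY n a ∂μ := by
    intro n
    have hfeas := shift_mem_feasible hμ (mem_feasible_integral (hHs n) (hHi n)) Z
    have hI1 := hρi.indicator (hD n)
    have h := le_integral_of_mem_feasible hr_meas hR hfeas
      (((hI1.add hYi).add (heXi n)).add (heYi n)) fun a => ?_
    · refine h.trans ?_
      rw [integral_add' ((hI1.add hYi).add (heXi n)) (heYi n),
        integral_add' (hI1.add hYi) (heXi n), integral_add' hI1 hYi, integral_indicator (hD n)]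
      linarith [(abs_le.1 (hDρ n)).2]
    · have hX0 : 0 ≤ eX n a := le_max_right _ _
      have hY0 : 0 ≤ eY n a := le_max_right _ _
      have hX1 : r a (GX n a + V n) - r a (X a) ≤ eX n a := le_max_left _ _
      have hY1 : r a (GY n a + V n) - r a (Y a) ≤ eY n a := le_max_left _ _
      change r a (H n a + V n) ≤ (D n).indicator ρ a + r a (Y a) + eX n a + eY n a
      by_cases ha : a ∈ D n
      · have hHa : H n a = GX n a := by
          simp only [hH, indicator_of_mem ha]
          exact sub_add_cancel _ _
        have hρa : (D n).indicator ρ a = r a (X a) - r a (Y a) := indicator_of_mem ha _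
        rw [hHa, hρa]
        linarith
      · have hHa : H n a = GY n a := by
          simp only [hH, indicator_of_notMem ha, zero_add]
        rw [hHa, indicator_of_notMem ha]
        linarith
  have hfinal := ge_of_tendsto' (((((hδlim.const_add (l * ∫ a, ρ a ∂μ))).add_const
    (∫ a, r a (Y a) ∂μ)).add heX).add heY) hle
  have hρ : ∫ a, ρ a ∂μ = ∫ a, r a (X a) ∂μ - ∫ a, r a (Y a) ∂μ := integral_sub hXi hYi
  rw [hρ] at hfinal
  linarith

end Convexity

end RiskSharing

/-! ### The theorem. -/

theorem theorem5p1 {A Ω : Type*} [MeasurableSpace A] [MeasurableSpace Ω]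
    (μ : Measure A) [IsFiniteMeasure μ] [μ.IsComplete] (hμ_pos : 0 < μ Set.univ)
    (hμ_nonatomic : RiskSharing.IsNonatomic μ)
    (P : Measure Ω) [IsProbabilityMeasure P] [IsSeparable P]
    (hP_nonatomic : RiskSharing.IsNonatomic P)
    (r : A → Lp ℝ ∞ P → ℝ)
    (hr_risk : ∀ a, RiskSharing.IsRiskMeasure P (r a))
    (hr_meas : RiskSharing.IsMeasurableFamily r)
    (hr_cons : ∃ (π : Finset (Set A)) (Q : Set A → Measure Ω),
      Setoid.IsPartition (π : Set (Set A)) ∧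
      ∀ B ∈ π, MeasurableSet B ∧ μ B ≠ 0 ∧
        IsProbabilityMeasure (Q B) ∧ Q B ≪ P ∧ P ≪ Q B ∧
        ∀ a ∈ B, RiskSharing.IsConsistent (Q B) (r a))
    (hr_leb : ∀ a, RiskSharing.HasLebesgueProperty P (r a))
    (hr_zero : Integrable (fun a => r a 0) μ)
    (h_finite : ∀ Z : Lp ℝ ∞ P, RiskSharing.integralInfConv μ r Z ≠ ⊥ ∧
      RiskSharing.integralInfConv μ r Z ≠ ⊤) :
    ∃ R : Lp ℝ ∞ P → ℝ,
      (∀ Z : Lp ℝ ∞ P, RiskSharing.integralInfConv μ r Z = (R Z : EReal)) ∧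
      RiskSharing.IsConvexRiskMeasure P R ∧ RiskSharing.HasLebesgueProperty P R := by
  have hR : ∀ Z, RiskSharing.integralInfConv μ r Z =
      ((RiskSharing.integralInfConv μ r Z).toReal : EReal) := fun Z =>
    (EReal.coe_toReal (h_finite Z).2 (h_finite Z).1).symm
  set R : Lp ℝ ∞ P → ℝ := fun Z => (RiskSharing.integralInfConv μ r Z).toReal
  have hμ : 0 < μ.real univ := ENNReal.toReal_pos hμ_pos.ne' (measure_ne_top _ _)
  obtain ⟨π, Q, hπ, hQ⟩ := hr_cons
  -- Each agent's block selects the measure Q under which that agent's position is averaged.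
  choose b hb using hπ.2
  have hblock : RiskSharing.IsBlockMap π b :=
    ⟨fun a => (hb a).1.1, fun a B hB => ⟨fun ha => ((hb a).2 B ⟨hB, ha⟩).symm,
      fun h => h ▸ (hb a).1.2⟩, fun B hB => (hQ B hB).1⟩
  obtain ⟨T, hT⟩ := RiskSharing.exists_finiteRank_approximation (P := P)
  have hTB := fun B hB => hT (Q B) (hQ B hB).2.2.1 (hQ B hB).2.2.2.1 (hQ B hB).2.2.2.2.1
  have hconv : ∀ (X Y : Lp ℝ ∞ P) (l : ℝ), 0 ≤ l → l ≤ 1 →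
      R (l • X + (1 - l) • Y) ≤ l * R X + (1 - l) * R Y := by
    intro X Y l hl0 hl1
    refine le_of_forall_pos_le_add fun ε hε => ?_
    obtain ⟨U, hU, hUi, hUlt⟩ :=
      RiskSharing.exists_mem_feasible_integral_lt hr_meas hR X hε
    obtain ⟨W, hW, hWi, hWlt⟩ :=
      RiskSharing.exists_mem_feasible_integral_lt hr_meas hR Y hε
    refine (RiskSharing.infConv_le_of_mem_feasible hμ hμ_nonatomic hr_risk hr_meas hr_leb hR hblock
      (T := fun B => T (Q B)) (fun B hB => (hTB B hB).1) (fun B hB => (hTB B hB).2.2.1)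
      (fun B hB => (hTB B hB).2.2.2) (fun a n V => (hQ _ (hb a).1.1).2.2.2.2.2 a (hb a).1.2 _ _
        ((hTB _ (hb a).1.1).2.1 n V)) hU hW hUi hWi hl0 hl1).trans ?_
    have h1 := mul_le_mul_of_nonneg_left hUlt.le hl0
    have h2 := mul_le_mul_of_nonneg_left hWlt.le (sub_nonneg.2 hl1)
    linarith
  exact ⟨R, hR, { RiskSharing.isRiskMeasure_infConv hμ hr_risk hr_meas hR with convex := hconv },
    RiskSharing.hasLebesgueProperty_infConv hμ hr_risk hr_meas hr_leb hR hconv⟩
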